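/- Let $\mathcal G$ be a weighted digraph with nodes $1,\dots,n$ ($n\ge 1$), $m$ arcs, and arc weights $w_{ij}\ge 0$ ($w_{ij}=0$ if $i\to j$ is not an arc). Put $d_i=\sum_j w_{ij}$ and $\mathbf L=\mathrm{diag}(d_1,\dots,d_n)-(w_{ij})$. The case of interest is the projected digraph of a hypergraph with hyperedge set $E$, hyperedge weights $h(e)\ge 0$ and contribution proportions $\gamma_e(i)\ge 0$ with $\sum_{i\in e}\gamma_e(i)=1$: its arcs are the pairs $i\to j$, $i\ne j$, with $i,j\in e$ for some $e\in E$, and $w_{ij}=\sum_{e\in E:\,i,j\in e} 2h(e)\gamma_e(j)/(|e|-1)$. An in-forest (spanning converging forest) of $\mathcal G$ is a set of arcs for which, in every weakly connected component of the resulting spanning subdigraph, one node (the root) has out-degree $0$ and all other nodes have out-degree $1$; its weight $\varepsilon$ is the product of its arc weights ($1$ if it has no arcs). Let $\Gamma$ be the set of all in-forests, $\Gamma_{ij}\subseteq\Gamma$ the set of those in which $i$ and $j$ lie in the same component with root $j$, and let $\phi$ be a random in-forest drawn with probability proportional to its weight. Let $x\in\mathbb R^n$ be the vector of internal opinions and let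 $\tau\ge 1$. Algorithm $\textsc{Sample}(\mathcal G,x,\tau)$ performs $\tau$ rounds. In each round it starts with the empty forest and, for $i=1,\dots,n$ in turn, walks from $u=i$ until it reaches a node already in the forest: at a node $u$ not in the forest it draws a uniform seed in $(0,1)$; if the seed is at most $1/(1+d_u)$, then $u$ joins the forest as a root, and otherwise the walk moves to a random successor $v$ of $u$ (chosen with probability $w_{uv}/d_u$), recording $v$ as the next node of $u$ and overwriting earlier records. Then the nodes met by following the recorded next nodes from $i$ join the forest, with the root of the node at which the walk ended. After the round, $x_{r(i)}/\tau$ is added to $\widehat z_i$ (initially $0$) for every $i$, where $r(i)$ is the root of $i$. Finally the algorithm returns $\widehat z$, together with $\sum_i\bigl(\widehat z_i-\frac1n\sum_k\widehat z_k\bigr)^2$. Elementary operations cost $1$, and drawing a random successor of $u$ costs the number of arcs leaving $u$. Then: 1. $\mathbf I+\mathbf L$ is invertible, and from every starting vector the Friedkin--Johnsen opinions $x_i^{(k+1)}=\dfrac{x_i+\sum_{j:\,i\to j}w_{ij}x_j^{(k)}}{1+\sum_{j:\,i\to j}w_{ij}}$ converge to $z=(\mathbf I+\mathbf L)^{-1}x$.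 2. $z_i=\sum_{j=1}^n \mathbb P(\phi\in\Gamma_{ij})\,x_j$ for every $i$. 3. In each round, with probability one, the algorithm completes an in-forest in which $r(i)$ is the root of $i$ for every $i$, and it obtains each in-forest with probability proportional to its weight. 4. For every $\tau\ge1$ the algorithm halts with probability one, and $\mathbb E[\widehat z_i]=z_i$ for every $i$. 5. The algorithm has expected running time $O(\tau(n+m))$ for bounded arc weights: there is an absolute constant $C$ such that, whenever all $w_{ij}\le W$, the expected number of operations is at most $C(1+W)\,\tau\,(n+m)$. -/

import Mathlib

open Filter Topology
open scoped ENNReal BigOperators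

/-! ### Weighted digraphs, Laplacian, Friedkin–Johnsen dynamics -/

/-- A weighted digraph on the nodes `Fin n`: a set of arcs, with nonnegative weights that vanish
off the arcs. The arc `i → j` is the pair `(i, j)`. -/
structure WeightedDigraph (n : ℕ) where
  arcs : Finset (Fin n × Fin n)
  w : Fin n → Fin n → ℝ
  w_nonneg : ∀ i j, 0 ≤ w i j
  w_eq_zero : ∀ i j, (i, j) ∉ arcs → w i j = 0

namespace WeightedDigraph

variable {n : ℕ}

/-- The out-neighbours of `i`. -/
def outNbrs (G : WeightedDigraph n) (i : Fin n) : Finset (Fin n) :=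
  Finset.univ.filter fun j => (i, j) ∈ G.arcs

/-- The weighted out-degree `d_i`. -/
def deg (G : WeightedDigraph n) (i : Fin n) : ℝ := ∑ j, G.w i j

/-- The Laplacian `L = D - A`. -/
def laplacian (G : WeightedDigraph n) : Matrix (Fin n) (Fin n) ℝ :=
  Matrix.diagonal G.deg - Matrix.of G.w

/-- One step of the Friedkin–Johnsen dynamics with internal opinions `x`. -/
noncomputable def fjUpdate (G : WeightedDigraph n) (x y : Fin n → ℝ) : Fin n → ℝ := fun i =>
  (x i + ∑ j ∈ G.outNbrs i, G.w i j * y j) / (1 + ∑ j ∈ G.outNbrs i, G.w i j)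

/-- The vector `(I + L)⁻¹ x`. -/
noncomputable def equilibrium (G : WeightedDigraph n) (x : Fin n → ℝ) : Fin n → ℝ :=
  (1 + G.laplacian)⁻¹.mulVec x

/-! ### Spanning converging forests (in-forests)

A spanning subdigraph is given by its set of arcs. -/

/-- `i` and `j` lie in the same weakly connected component of the spanning subdigraph `F`. -/
def SameComponent (F : Finset (Fin n × Fin n)) (i j : Fin n) : Prop :=
  Relation.EqvGen (fun a b => (a, b) ∈ F) i j

/-- The number of arcs of `F` leaving `i`. -/
def outCount (F : Finset (Fin n × Fin n)) (i : Fin n) : ℕ :=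
  (F.filter fun e => e.1 = i).card

/-- `F` is a spanning converging forest of `G`: a set of arcs of `G` such that in every weakly
connected component one node has out-degree `0` and every other node has out-degree `1`. -/
def IsInForest (G : WeightedDigraph n) (F : Finset (Fin n × Fin n)) : Prop :=
  F ⊆ G.arcs ∧ ∀ i, ∃ r, SameComponent F i r ∧ outCount F r = 0 ∧
    ∀ v, SameComponent F i v → v ≠ r → outCount F v = 1

open scoped Classical in
/-- `Γ`, the set of all in-forests of `G`. -/
noncomputable def inForests (G : WeightedDigraph n) : Finset (Finset (Fin n × Fin n)) :=
  G.arcs.powerset.filter G.IsInForest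

open scoped Classical in
/-- `Γ_ij`: the in-forests in which `i` and `j` are in the same in-tree and `j` is its root. -/
noncomputable def inForestsRootedAt (G : WeightedDigraph n) (i j : Fin n) :
    Finset (Finset (Fin n × Fin n)) :=
  G.inForests.filter fun F => SameComponent F i j ∧ outCount F j = 0

/-- The weight `ε(F)`: the product of the weights of the arcs of `F`. -/
def forestWeight (G : WeightedDigraph n) (F : Finset (Fin n × Fin n)) : ℝ :=
  ∏ e ∈ F, G.w e.1 e.2

theorem empty_mem_inForests (G : WeightedDigraph n) : ∅ ∈ G.inForests := by
  classical
  simp only [inForests, Finset.mem_filter, Finset.mem_powerset, Finset.empty_subset, true_and]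
  refine ⟨Finset.empty_subset _, fun i => ⟨i, Relation.EqvGen.refl i, by simp [outCount], ?_⟩⟩
  have key : ∀ a b : Fin n, SameComponent (∅ : Finset (Fin n × Fin n)) a b → a = b := by
    intro a b h
    induction h with
    | rel a b h => simp at h
    | refl a => rfl
    | symm a b _ ih => exact ih.symm
    | trans a b c _ _ ih1 ih2 => exact ih1.trans ih2
  intro v hv hne
  exact absurd (key i v hv).symm hne

open scoped Classical in
/-- The weight `ε(F)` of an in-forest, and `0` for every other set of arcs. -/
noncomputable def forestMass (G : WeightedDigraph n) (F : Finset (Fin n × Fin n)) : ℝ≥0∞ :=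
  if F ∈ G.inForests then ENNReal.ofReal (G.forestWeight F) else 0

theorem tsum_forestMass_ne_zero (G : WeightedDigraph n) : ∑' F, G.forestMass F ≠ 0 := by
  intro h
  have h0 := ENNReal.tsum_eq_zero.1 h ∅
  simp [forestMass, G.empty_mem_inForests, forestWeight] at h0

theorem tsum_forestMass_ne_top (G : WeightedDigraph n) : ∑' F, G.forestMass F ≠ ∞ := by
  rw [tsum_fintype]
  refine ENNReal.sum_ne_top.2 fun F _ => ?_
  unfold forestMass
  split_ifs <;> simp

/-- The law of a random in-forest drawn with probability proportional to its weight. -/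
noncomputable def forestPMF (G : WeightedDigraph n) : PMF (Finset (Fin n × Fin n)) :=
  PMF.normalize G.forestMass G.tsum_forestMass_ne_zero G.tsum_forestMass_ne_top

/-- `ℙ(φ ∈ S)` for a random in-forest `φ` drawn with probability proportional to its weight. -/
noncomputable def forestProb (G : WeightedDigraph n) (S : Finset (Finset (Fin n × Fin n))) : ℝ :=
  (G.forestPMF.toOuterMeasure (S : Set (Finset (Fin n × Fin n)))).toReal

end WeightedDigraph

/-! ### Hypergraphs and their projected digraphs -/

/-- A weighted hypergraph on `Fin n`: hyperedges `e` with weights `h e` and contribution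
proportions `γ e i` of the members `i` of `e`. -/
structure WeightedHypergraph (n : ℕ) where
  edges : Finset (Finset (Fin n))
  h : Finset (Fin n) → ℝ
  γ : Finset (Fin n) → Fin n → ℝ
  h_nonneg : ∀ e ∈ edges, 0 ≤ h e
  γ_nonneg : ∀ e ∈ edges, ∀ i ∈ e, 0 ≤ γ e i
  γ_sum : ∀ e ∈ edges, ∑ i ∈ e, γ e i = 1

/-- The projected digraph of a hypergraph. -/
noncomputable def WeightedHypergraph.projectedDigraph {n : ℕ} (H : WeightedHypergraph n) :
    WeightedDigraph n where
  arcs := Finset.univ.filter fun p => p.1 ≠ p.2 ∧ ∃ e ∈ H.edges, p.1 ∈ e ∧ p.2 ∈ e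
  w i j := if i ≠ j then
      ∑ e ∈ H.edges.filter (fun e => i ∈ e ∧ j ∈ e),
        2 * (H.h e * H.γ e j * (1 / ((e.card : ℝ) - 1)))
    else 0
  w_nonneg i j := by
    split_ifs with hij
    · refine Finset.sum_nonneg fun e he => ?_
      obtain ⟨he, hi, hj⟩ := Finset.mem_filter.1 he
      have h1 : (1 : ℝ) ≤ (e.card : ℝ) := by
        exact_mod_cast Finset.card_pos.2 ⟨i, hi⟩
      exact mul_nonneg zero_le_two (mul_nonneg
        (mul_nonneg (H.h_nonneg e he) (H.γ_nonneg e he j hj))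
        (one_div_nonneg.2 (sub_nonneg.2 h1)))
    · exact le_rfl
  w_eq_zero i j hij := by
    split_ifs with hne
    · refine Finset.sum_eq_zero fun e he => ?_
      obtain ⟨he, hi, hj⟩ := Finset.mem_filter.1 he
      exact absurd (Finset.mem_filter.2 ⟨Finset.mem_univ _, hne, e, he, hi, hj⟩) hij
    · rfl

/-! ### Randomized programs with a step count -/

/-- A randomized program with results in `α`, given by the probability of every pair
(result, number of elementary operations executed). The total mass is the probability that the
program halts. -/
def RandProg (α : Type) : Type := α × ℕ → ℝ≥0∞

namespace RandProg

open scoped Classical in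
/-- Programs returning a value at no cost, and sequential composition, which adds costs. -/
noncomputable instance : Monad RandProg where
  pure a := fun o => if o = (a, 0) then 1 else 0
  bind p f := fun o =>
    ∑' a, ∑ k ∈ Finset.HasAntidiagonal.antidiagonal o.2, p (a, k.1) * f a (o.1, k.2)

/-- Execute `k` elementary operations (without changing any value). -/
def tick (k : ℕ) : RandProg Unit := fun o => if o.2 = k then 1 else 0

/-- Draw `seed` uniformly from `(0, 1)` and return the truth value of `seed ≤ p`:
two operations. -/
noncomputable def randLE (p : ℝ) : RandProg Bool := fun o =>
  if o.2 = 2 then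
    MeasureTheory.volume {seed : ℝ | seed ∈ Set.Ioo 0 1 ∧ (o.1 = true ↔ seed ≤ p)}
  else 0

/-- The loop `while cond do body`, cut off (without any result) at the `k`-th test of `cond`.
Every test costs one operation. -/
noncomputable def whileFuel {σ : Type} (cond : σ → Bool) (body : σ → RandProg σ) :
    ℕ → σ → RandProg σ
  | 0, _ => fun _ => 0
  | k + 1, s => do
    tick 1
    if cond s then
      let s' ← body s
      whileFuel cond body k s'
    else
      pure s

/-- The loop `while cond do body`: the limit (pointwise supremum) of its cut-off versions. -/
noncomputable def whileLoop {σ : Type} (cond : σ → Bool) (body : σ → RandProg σ) (s : σ) :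
    RandProg σ := fun o => ⨆ k, whileFuel cond body k s o

/-- The probability that the program halts with a result satisfying `Q`. -/
noncomputable def prob {α : Type} (p : RandProg α) (Q : α → Prop) : ℝ≥0∞ :=
  ∑' o : α × ℕ, Set.indicator {o | Q o.1} p o

/-- The expected number of operations (for a program that halts with probability one). -/
noncomputable def expectedCost {α : Type} (p : RandProg α) : ℝ≥0∞ :=
  ∑' o : α × ℕ, p o * (o.2 : ℝ≥0∞)

/-- `f` of the result has an (absolutely convergent) expectation, and it is `e`. -/
def HasExpectation {α : Type} (p : RandProg α) (f : α → ℝ) (e : ℝ) : Prop :=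
  HasSum (fun o : α × ℕ => (p o).toReal * f o.1) e

end RandProg

/-! ### The algorithm `Sample` -/

/-- The arrays `Inforest`, `Nextnode` (`none` stands for `-1`) and `Rootindex`
(`none` stands for the initial value `0`, which is no node). -/
structure SampleState (n : ℕ) where
  inforest : Fin n → Bool
  next : Fin n → Option (Fin n)
  root : Fin n → Option (Fin n)

namespace SampleState

/-- The initial arrays. -/
def init (n : ℕ) : SampleState n := ⟨fun _ => false, fun _ => none, fun _ => none⟩

/-- The set of arcs `u → Nextnode[u]`. -/
def nextArcs {n : ℕ} (s : SampleState n) : Finset (Fin n × Fin n) :=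
  Finset.univ.filter fun e => s.next e.1 = some e.2

end SampleState

namespace WeightedDigraph

open RandProg

variable {n : ℕ}

/-- `RandomSuccessor(u, G)`: a random node, equal to `v` with probability `w_uv / d_u`. It is
charged one operation for every arc leaving `u` (a scan of the list of these arcs). -/
noncomputable def randomSuccessor (G : WeightedDigraph n) (u : Fin n) : RandProg (Fin n) :=
  fun o => if o.2 = outCount G.arcs u then ENNReal.ofReal (G.w u o.1 / G.deg u) else 0

/-- The body of the first inner loop: at the current node `u`, either end the walk and make `u` a root, or
move to a random successor of `u` and record it. -/
noncomputable def walkBody (G : WeightedDigraph n) :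
    Fin n × SampleState n → RandProg (Fin n × SampleState n)
  | (u, s) => do
    let absorbed ← randLE (1 / (1 + G.deg u))
    if absorbed then
      tick 3
      pure (u, { inforest := Function.update s.inforest u true
                 next := Function.update s.next u none
                 root := Function.update s.root u (some u) })
    else
      let v ← G.randomSuccessor u
      tick 2
      pure (v, { s with next := Function.update s.next u (some v) })

/-- The body of the second inner loop: add the current node `u` to the forest with root `rootnow`
and move on to `Nextnode[u]`. -/
noncomputable def retraceBody (rootnow : Option (Fin n)) :
    Fin n × SampleState n → RandProg (Fin n × SampleState n)
  | (u, s) => do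
    tick 3
    pure ((s.next u).getD u,
      { s with
        inforest := Function.update s.inforest u true
        root := Function.update s.root u rootnow })

/-- The work done for one node `i`: walk from `i` until the current forest is hit, then retrace the
loop-erased walk and add it to the forest. -/
noncomputable def visitNode (G : WeightedDigraph n) (s : SampleState n) (i : Fin n) :
    RandProg (SampleState n) := do
  tick 2
  let (u, s) ← whileLoop (fun (u, s) => !s.inforest u) G.walkBody (i, s)
  tick 2
  let rootnow := s.root u
  let (_, s) ← whileLoop (fun (u, s) => !s.inforest u) (retraceBody rootnow) (i, s)
  pure s

/-- One round of the algorithm: reset the three arrays, then treat the nodes one by one. -/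
noncomputable def sampleForest (G : WeightedDigraph n) : RandProg (SampleState n) := do
  tick (3 * n)
  List.foldlM G.visitNode (SampleState.init n) (List.finRange n)

/-- The algorithm `Sample(G, x, τ)`. It returns the estimate `ẑ` and the polarization estimate.
The first line initializes `ẑ` and computes the table of the out-degrees `d_u`. -/
noncomputable def sample (G : WeightedDigraph n) (x : Fin n → ℝ) (τ : ℕ) :
    RandProg ((Fin n → ℝ) × ℝ) := do
  tick (2 * n + G.arcs.card)
  let zhat ← List.foldlM (fun (zhat : Fin n → ℝ) (_ : ℕ) => do
      let s ← G.sampleForest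
      tick (3 * n + 1)
      pure fun i => zhat i + (s.root i).elim 0 x / (τ : ℝ))
    (fun _ => 0) (List.range τ)
  tick (4 * n + 1)
  let mean := (∑ i, zhat i) / (n : ℝ)
  pure (zhat, ∑ i, (zhat i - mean) ^ 2)

end WeightedDigraph

/-!
An in-forest is an acyclic pointer map: each node is a root or points along its unique outgoing arc.
Exchanging the pointer of `i` with another choice for it preserves the total weight, which gives
`(I + L) P = I` for the matrix `P` of the probabilities `ℙ(φ ∈ Γ_ij)`, and hence `z = P x`. The
Friedkin–Johnsen map is a sup-norm contraction with fixed point `z`.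

In the algorithm, records left at nodes outside the forest are overwritten before they are read, so
a round may as well start from random records, with the law of the in-forest itself. Each step of
the walk resamples the pointer of the current node. This makes the law of the walk explicit: the
expected number of times that it is at `u` with records `f` is the relative weight of `f` if cutting
the pointer of `u` makes `f` acyclic and `f` leads from the starting node to `u` outside the forest,
and `0` otherwise. It follows that every walk preserves the law of the in-forest. A visit to `u`
makes `u` a root with probability `1 / (1 + d_u)`, so a round makes `(1 + d_u) ℙ(φ ∈ Γ_uu)` visits
to `u` on average; by the diagonal of `P (I + L) = I` this is at most `1 + max w`, which bounds
the running time.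
-/

/-! ### Expectations of randomized programs -/

namespace RandProg

variable {α β σ : Type}

/-- The weakest preexpectation: the expectation of `g result cost` over the halting executions.
It determines the program, and it is what makes programs compositional to reason about. -/
noncomputable def wp (p : RandProg α) (g : α → ℕ → ℝ≥0∞) : ℝ≥0∞ :=
  ∑' o : α × ℕ, p o * g o.1 o.2

/-- The expectation of `g result` over the halting executions. -/
noncomputable def expect (p : RandProg α) (g : α → ℝ≥0∞) : ℝ≥0∞ :=
  p.wp fun a _ => g a

/-- The probability that a program halts. -/
noncomputable def haltProb (p : RandProg α) : ℝ≥0∞ :=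
  p.expect fun _ => 1

theorem wp_mono {p : RandProg α} {g g' : α → ℕ → ℝ≥0∞} (h : ∀ a k, g a k ≤ g' a k) :
    p.wp g ≤ p.wp g' :=
  ENNReal.tsum_le_tsum fun o => mul_le_mul_right (h o.1 o.2) _

theorem expect_mono {p : RandProg α} {g g' : α → ℝ≥0∞} (h : ∀ a, g a ≤ g' a) :
    p.expect g ≤ p.expect g' :=
  wp_mono fun a _ => h a

theorem wp_add (p : RandProg α) (g g' : α → ℕ → ℝ≥0∞) :
    (p.wp fun a k => g a k + g' a k) = p.wp g + p.wp g' := by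
  simp only [wp, mul_add, ENNReal.tsum_add]

theorem expect_add (p : RandProg α) (g g' : α → ℝ≥0∞) :
    (p.expect fun a => g a + g' a) = p.expect g + p.expect g' :=
  wp_add p _ _

theorem wp_const_mul (p : RandProg α) (c : ℝ≥0∞) (g : α → ℕ → ℝ≥0∞) :
    (p.wp fun a k => c * g a k) = c * p.wp g := by
  simp only [wp, mul_left_comm, ENNReal.tsum_mul_left]

theorem expect_const_mul (p : RandProg α) (c : ℝ≥0∞) (g : α → ℝ≥0∞) :
    (p.expect fun a => c * g a) = c * p.expect g :=
  wp_const_mul p c _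

theorem expect_const (p : RandProg α) (c : ℝ≥0∞) : (p.expect fun _ => c) = c * p.haltProb := by
  rw [haltProb, ← expect_const_mul, mul_one]

theorem expect_le_of_le {p : RandProg α} {g : α → ℝ≥0∞} {c : ℝ≥0∞} (hp : p.haltProb ≤ 1)
    (hg : ∀ a, g a ≤ c) : p.expect g ≤ c :=
  (expect_mono hg).trans ((p.expect_const c).trans_le (mul_le_of_le_one_right' hp))

theorem expectedCost_eq_wp (p : RandProg α) : p.expectedCost = p.wp fun _ k => (k : ℝ≥0∞) := rfl

theorem prob_eq_expect (p : RandProg α) (Q : α → Prop) [DecidablePred Q] :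
    p.prob Q = p.expect fun a => if Q a then 1 else 0 := by
  refine tsum_congr fun o => ?_
  by_cases h : Q o.1 <;> simp [Set.indicator, h]

theorem prob_true (p : RandProg α) : (p.prob fun _ => True) = p.haltProb := by
  simp only [prob_eq_expect, if_true, haltProb]

theorem expect_eq_tsum [DecidableEq α] (p : RandProg α) (g : α → ℝ≥0∞) :
    p.expect g = ∑' a, (p.expect fun b => if b = a then 1 else 0) * g a := by
  simp only [expect, wp, ← ENNReal.tsum_mul_right]
  rw [ENNReal.tsum_comm]
  refine tsum_congr fun o => ?_
  rw [tsum_eq_single o.1 fun a ha => by simp [ha.symm]]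
  simp

theorem tsum_mul_iSup_of_monotone {ι : Type*} (a : ι → ℝ≥0∞) {f : ℕ → ι → ℝ≥0∞}
    (hf : ∀ i, Monotone fun k => f k i) : ∑' i, a i * ⨆ k, f k i = ⨆ k, ∑' i, a i * f k i := by
  simp only [ENNReal.mul_iSup, ENNReal.tsum_eq_iSup_sum]
  rw [iSup_comm]
  exact iSup_congr fun t =>
    ENNReal.finsetSum_iSup_of_monotone fun i _ _ hkl => mul_le_mul_right (hf i hkl) _

theorem expect_iSup (p : RandProg α) {g : ℕ → α → ℝ≥0∞} (hg : ∀ a, Monotone fun k => g k a) :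
    (p.expect fun a => ⨆ k, g k a) = ⨆ k, p.expect (g k) :=
  tsum_mul_iSup_of_monotone p fun o => hg o.1

theorem sum_mul_expect_eq_of_le_one {ι : Type*} [Fintype ι] (P : ι → RandProg α) (Q : ι → α)
    (a : ι → ℝ≥0∞)
    (h : ∀ g : α → ℝ≥0∞, (∀ x, g x ≤ 1) → ∑ i, a i * (P i).expect g = ∑ i, a i * g (Q i))
    (g : α → ℝ≥0∞) : ∑ i, a i * (P i).expect g = ∑ i, a i * g (Q i) := by
  classical
  calc ∑ i, a i * (P i).expect g
      = ∑ i, ∑' x, a i * ((P i).expect fun b => if b = x then 1 else 0) * g x := by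
        refine Finset.sum_congr rfl fun i _ => ?_
        rw [expect_eq_tsum, ← ENNReal.tsum_mul_left]
        simp only [mul_assoc]
    _ = ∑' x, ∑ i, a i * (if Q i = x then 1 else 0) * g x := by
        rw [← Summable.tsum_finsetSum fun _ _ => ENNReal.summable]
        simp only [← Finset.sum_mul]
        exact tsum_congr fun x => by rw [h _ fun b => by split_ifs <;> simp]
    _ = ∑ i, a i * g (Q i) := by
        rw [Summable.tsum_finsetSum fun _ _ => ENNReal.summable]
        refine Finset.sum_congr rfl fun i _ => ?_
        rw [tsum_eq_single (Q i) fun x hx => by simp [hx.symm]]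
        simp

/-! ### Calculation rules for programs -/

theorem wp_pure (a : α) (g : α → ℕ → ℝ≥0∞) : wp (pure a : RandProg α) g = g a 0 := by
  classical
  have pure_apply : ∀ o : α × ℕ,
      (pure a : RandProg α) o = if o = (a, 0) then 1 else 0 := fun o => by
    change (if o = (a, 0) then _ else _) = _
    congr
  simp only [wp, pure_apply]
  rw [tsum_eq_single (a, 0) fun o ho => by simp [ho]]
  simp

open Finset.HasAntidiagonal in
theorem tsum_sum_antidiagonal_mul (a b : ℕ → ℝ≥0∞) (c : ℕ → ℝ≥0∞) :
    ∑' l, (∑ k ∈ antidiagonal l, a k.1 * b k.2) * c l = ∑' k, ∑' l, a k * (b l * c (k + l)) := by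
  rw [← ENNReal.tsum_prod, ← Finset.HasAntidiagonal.sigmaAntidiagonalEquivProd.tsum_eq,
    ENNReal.tsum_sigma']
  refine tsum_congr fun l => ?_
  rw [tsum_fintype, Finset.sum_mul, ← Finset.sum_coe_sort]
  refine Finset.sum_congr rfl fun k _ => ?_
  rw [sigmaAntidiagonalEquivProd_apply]
  rw [mem_antidiagonal.1 k.2, mul_assoc]

theorem wp_bind (p : RandProg α) (f : α → RandProg β) (g : β → ℕ → ℝ≥0∞) :
    wp (p >>= f) g = p.wp fun a k => (f a).wp fun b l => g b (k + l) := by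
  have bind_apply : ∀ o : β × ℕ, (p >>= f) o =
      ∑' a, ∑ k ∈ Finset.HasAntidiagonal.antidiagonal o.2, p (a, k.1) * f a (o.1, k.2) :=
    fun _ => rfl
  simp only [wp, bind_apply, ENNReal.tsum_prod', ← ENNReal.tsum_mul_right,
    ← ENNReal.tsum_mul_left]
  calc _ = ∑' (b : β) (a : α) (k : ℕ) (l : ℕ), p (a, k) * (f a (b, l) * g b (k + l)) := by
        refine tsum_congr fun b => ?_
        rw [ENNReal.tsum_comm]
        exact tsum_congr fun a =>
          tsum_sum_antidiagonal_mul (fun k => p (a, k)) (fun l => f a (b, l)) (g b)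
    _ = _ := by
        rw [ENNReal.tsum_comm]
        exact tsum_congr fun a => ENNReal.tsum_comm

theorem wp_tick (k : ℕ) (g : Unit → ℕ → ℝ≥0∞) : (tick k).wp g = g () k := by
  rw [wp, tsum_eq_single ((), k)]
  · simp [tick]
  · rintro ⟨⟨⟩, l⟩ hl
    have : l ≠ k := fun h => hl (by rw [h])
    simp [tick, this]

theorem wp_of_const_cost (q : α → ℝ≥0∞) (c : ℕ) (g : α → ℕ → ℝ≥0∞) :
    wp (fun o => if o.2 = c then q o.1 else 0 : RandProg α) g = ∑' a, q a * g a c := by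
  simp only [wp]
  rw [ENNReal.tsum_prod']
  refine tsum_congr fun a => ?_
  rw [tsum_eq_single c fun k hk => by simp [hk]]
  simp

theorem volume_seed_le {p : ℝ} (h1 : p ≤ 1) :
    MeasureTheory.volume {seed : ℝ | seed ∈ Set.Ioo 0 1 ∧ (true = true ↔ seed ≤ p)} =
      ENNReal.ofReal p := by
  refine le_antisymm ?_ ?_
  · refine (MeasureTheory.measure_mono (t := Set.Ioc 0 p) ?_).trans (by simp)
    rintro x ⟨hx, hp⟩
    exact ⟨hx.1, hp.1 rfl⟩
  · refine le_trans (by simp) (MeasureTheory.measure_mono (s := Set.Ioo 0 p) ?_)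
    rintro x ⟨hx, hp⟩
    exact ⟨⟨hx, hp.trans_le h1⟩, fun _ => hp.le, fun _ => rfl⟩

theorem volume_lt_seed {p : ℝ} (h0 : 0 ≤ p) :
    MeasureTheory.volume {seed : ℝ | seed ∈ Set.Ioo 0 1 ∧ (false = true ↔ seed ≤ p)} =
      ENNReal.ofReal (1 - p) := by
  rw [← Real.volume_Ioo]
  congr 1
  ext x
  simp only [Set.mem_ofPred_eq, Set.mem_Ioo, Bool.false_eq_true, false_iff, not_le]
  exact ⟨fun h => ⟨h.2, h.1.2⟩, fun h => ⟨⟨h0.trans_lt h.1, h.2⟩, h.1⟩⟩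

theorem wp_randLE {p : ℝ} (h0 : 0 ≤ p) (h1 : p ≤ 1) (g : Bool → ℕ → ℝ≥0∞) :
    (randLE p).wp g = ENNReal.ofReal p * g true 2 + ENNReal.ofReal (1 - p) * g false 2 := by
  have h := wp_of_const_cost (fun b : Bool =>
    MeasureTheory.volume {seed : ℝ | seed ∈ Set.Ioo 0 1 ∧ (b = true ↔ seed ≤ p)}) 2 g
  rwa [tsum_fintype, Fintype.sum_bool, volume_seed_le h1, volume_lt_seed h0] at h

theorem expect_pure (a : α) (g : α → ℝ≥0∞) : expect (pure a : RandProg α) g = g a := wp_pure a _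

theorem expect_bind (p : RandProg α) (f : α → RandProg β) (g : β → ℝ≥0∞) :
    expect (p >>= f) g = p.expect fun a => (f a).expect g :=
  wp_bind p f _

theorem expect_tick (k : ℕ) (g : Unit → ℝ≥0∞) : (tick k).expect g = g () := wp_tick k _

theorem haltProb_pure (a : α) : haltProb (pure a : RandProg α) = 1 := expect_pure a _

theorem haltProb_tick (k : ℕ) : (tick k).haltProb = 1 := expect_tick k _

theorem haltProb_bind_le_one {p : RandProg α} {f : α → RandProg β} (hp : p.haltProb ≤ 1)
    (hf : ∀ a, (f a).haltProb ≤ 1) : haltProb (p >>= f) ≤ 1 := by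
  rw [haltProb, expect_bind]
  exact expect_le_of_le hp hf

theorem haltProb_bind_eq_one {p : RandProg α} {f : α → RandProg β} (hp : p.haltProb = 1)
    (hf : ∀ a, (f a).haltProb = 1) : haltProb (p >>= f) = 1 := by
  rw [haltProb, expect_bind]
  exact (congrArg p.expect (funext hf)).trans hp

theorem expectedCost_pure (a : α) : (pure a : RandProg α).expectedCost = 0 := by
  simp [expectedCost_eq_wp, wp_pure]

theorem expectedCost_tick (k : ℕ) : (tick k).expectedCost = k :=
  wp_tick k fun _ c => (c : ℝ≥0∞)

theorem expectedCost_bind_le (p : RandProg α) (f : α → RandProg β) (hf : ∀ a, (f a).haltProb ≤ 1) :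
    (p >>= f).expectedCost ≤ p.expectedCost + p.expect fun a => (f a).expectedCost := by
  simp only [expectedCost_eq_wp, wp_bind, expect, ← wp_add]
  refine wp_mono fun a k => ?_
  simp only [Nat.cast_add, wp_add]
  gcongr
  exact expect_le_of_le (hf a) fun _ => le_rfl

theorem expectedCost_tick_bind_le (k : ℕ) (f : Unit → RandProg β) (hf : (f ()).haltProb ≤ 1) :
    (tick k >>= f).expectedCost ≤ k + (f ()).expectedCost := by
  refine (expectedCost_bind_le _ _ fun _ => hf).trans_eq ?_
  rw [expectedCost_tick, expect_tick]

/-! ### Means -/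

/-- The mean of `f`, in terms of its positive and negative parts. Unlike `HasExpectation` this
depends on `p` only through `p.expect`, so that the calculation rules apply. -/
def HasMean (p : RandProg α) (f : α → ℝ) (e : ℝ) : Prop :=
  (p.expect fun a => ENNReal.ofReal (f a)) ≠ ∞ ∧ (p.expect fun a => ENNReal.ofReal (-f a)) ≠ ∞ ∧
    (p.expect fun a => ENNReal.ofReal (f a)).toReal -
      (p.expect fun a => ENNReal.ofReal (-f a)).toReal = e

theorem HasMean.hasExpectation {p : RandProg α} {f : α → ℝ} {e : ℝ} (h : p.HasMean f e) :
    p.HasExpectation f e := by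
  obtain ⟨hpos, hneg, rfl⟩ := h
  have hasSum_part : ∀ g : α → ℝ≥0∞, p.expect g ≠ ∞ →
      HasSum (fun o : α × ℕ => (p o).toReal * (g o.1).toReal) (p.expect g).toReal := by
    intro g hg
    have h := ENNReal.hasSum_toReal hg
    rw [← ENNReal.tsum_toReal_eq (ENNReal.ne_top_of_tsum_ne_top hg)] at h
    simp only [ENNReal.toReal_mul] at h
    exact h
  refine ((hasSum_part _ hpos).sub (hasSum_part _ hneg)).congr_fun fun o => ?_
  rw [← mul_sub, ENNReal.toReal_ofReal', ENNReal.toReal_ofReal', max_zero_sub_max_neg_zero_eq_self]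

theorem hasMean_pure (a : α) (f : α → ℝ) : (pure a : RandProg α).HasMean f (f a) := by
  refine ⟨?_, ?_, ?_⟩ <;> simp only [expect_pure]
  · exact ENNReal.ofReal_ne_top
  · exact ENNReal.ofReal_ne_top
  · rw [ENNReal.toReal_ofReal', ENNReal.toReal_ofReal', max_zero_sub_max_neg_zero_eq_self]

theorem HasMean.bind {ι : Type*} [Fintype ι] {p : RandProg α} {a : ι → ℝ≥0∞} {Q : ι → α}
    (ha : ∀ i, a i ≠ ∞) (hp : ∀ g : α → ℝ≥0∞, p.expect g = ∑ i, a i * g (Q i))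
    {k : α → RandProg β} {f : β → ℝ} {e : ι → ℝ} (hk : ∀ i, (k (Q i)).HasMean f (e i)) :
    (p >>= k).HasMean f (∑ i, (a i).toReal * e i) := by
  have mul_ne_top : ∀ g : β → ℝ≥0∞, (∀ i, (k (Q i)).expect g ≠ ∞) →
      ∀ i ∈ Finset.univ, a i * (k (Q i)).expect g ≠ ∞ :=
    fun g hg i _ => ENNReal.mul_ne_top (ha i) (hg i)
  have pos_ne_top := mul_ne_top _ fun i => (hk i).1
  have neg_ne_top := mul_ne_top _ fun i => (hk i).2.1
  refine ⟨?_, ?_, ?_⟩ <;> rw [expect_bind, hp]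
  · exact ENNReal.sum_ne_top.2 pos_ne_top
  · exact ENNReal.sum_ne_top.2 neg_ne_top
  · rw [expect_bind, hp, ENNReal.toReal_sum pos_ne_top, ENNReal.toReal_sum neg_ne_top,
      ← Finset.sum_sub_distrib]
    exact Finset.sum_congr rfl fun i _ => by
      rw [ENNReal.toReal_mul, ENNReal.toReal_mul, ← mul_sub, (hk i).2.2]

/-! ### Iteration over a list -/

section FoldlM

variable {ι : Type} {f : σ → ι → RandProg σ}

theorem haltProb_foldlM_le_one (hf : ∀ s i, (f s i).haltProb ≤ 1) (l : List ι) (s : σ) :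
    (List.foldlM f s l).haltProb ≤ 1 := by
  induction l generalizing s with
  | nil => exact (haltProb_pure s).le
  | cons i l ih => exact haltProb_bind_le_one (hf s i) ih

theorem haltProb_foldlM_eq_one (hf : ∀ s i, (f s i).haltProb = 1) (l : List ι) (s : σ) :
    (List.foldlM f s l).haltProb = 1 := by
  induction l generalizing s with
  | nil => exact haltProb_pure s
  | cons i l ih => exact haltProb_bind_eq_one (hf s i) ih

theorem expectedCost_foldlM_le (hf : ∀ s i, (f s i).haltProb ≤ 1) {c : ℝ≥0∞}
    (hc : ∀ s i, (f s i).expectedCost ≤ c) (l : List ι) (s : σ) :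
    (List.foldlM f s l).expectedCost ≤ l.length * c := by
  induction l generalizing s with
  | nil => exact (expectedCost_pure s).trans_le zero_le
  | cons i l ih =>
    calc (List.foldlM f s (i :: l)).expectedCost
        ≤ (f s i).expectedCost + (f s i).expect fun s' => (List.foldlM f s' l).expectedCost :=
          expectedCost_bind_le _ _ (haltProb_foldlM_le_one hf l)
      _ ≤ c + l.length * c := add_le_add (hc s i) (expect_le_of_le (hf s i) ih)
      _ = (i :: l).length * c := by rw [List.length_cons]; push_cast; ring

end FoldlM

/-! ### While loops -/

section WhileLoop

variable {cond : σ → Bool} {body : σ → RandProg σ}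

theorem whileFuel_succ_eq (k : ℕ) (s : σ) : whileFuel cond body (k + 1) s =
    tick 1 >>= fun _ => if cond s then body s >>= whileFuel cond body k else pure s := rfl

theorem wp_whileFuel_zero (s : σ) (g : σ → ℕ → ℝ≥0∞) : (whileFuel cond body 0 s).wp g = 0 := by
  simp [wp, whileFuel]

theorem wp_whileFuel_succ (k : ℕ) (s : σ) (g : σ → ℕ → ℝ≥0∞) :
    (whileFuel cond body (k + 1) s).wp g = if cond s then
      (body s).wp fun s' c => (whileFuel cond body k s').wp fun a l => g a (1 + (c + l))
    else g s 1 := by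
  rw [whileFuel_succ_eq, wp_bind, wp_tick]
  split_ifs
  · rw [wp_bind]
  · rw [wp_pure]

theorem expect_whileFuel_succ (k : ℕ) (s : σ) (g : σ → ℝ≥0∞) :
    (whileFuel cond body (k + 1) s).expect g = if cond s then
      (body s).expect fun s' => (whileFuel cond body k s').expect g
    else g s :=
  wp_whileFuel_succ k s _

theorem bind_mono {p : RandProg α} {f f' : α → RandProg β} (h : ∀ a o, f a o ≤ f' a o)
    (o : β × ℕ) : (p >>= f) o ≤ (p >>= f') o :=
  ENNReal.tsum_le_tsum fun a => Finset.sum_le_sum fun _ _ => mul_le_mul_right (h a _) _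

theorem monotone_whileFuel (s : σ) (o : σ × ℕ) : Monotone fun k => whileFuel cond body k s o := by
  refine monotone_nat_of_le_succ fun k => ?_
  induction k generalizing s o with
  | zero => exact zero_le
  | succ k ih =>
    rw [whileFuel_succ_eq, whileFuel_succ_eq]
    refine bind_mono (fun _ o => ?_) o
    split_ifs
    · exact bind_mono (fun a o => ih a o) o
    · exact le_rfl

theorem monotone_wp_whileFuel (s : σ) (g : σ → ℕ → ℝ≥0∞) :
    Monotone fun k => (whileFuel cond body k s).wp g := fun _ _ hkl =>
  ENNReal.tsum_le_tsum fun o => mul_le_mul_left (monotone_whileFuel s o hkl) _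

theorem wp_whileLoop (s : σ) (g : σ → ℕ → ℝ≥0∞) :
    (whileLoop cond body s).wp g = ⨆ k, (whileFuel cond body k s).wp g := by
  simp only [wp, mul_comm _ (g _ _)]
  exact tsum_mul_iSup_of_monotone _ fun o => monotone_whileFuel s o

theorem expect_whileLoop (s : σ) (g : σ → ℝ≥0∞) : (whileLoop cond body s).expect g =
    if cond s then (body s).expect fun s' => (whileLoop cond body s').expect g else g s := by
  have expect_eq_iSup : ∀ s, (whileLoop cond body s).expect g =
      ⨆ k, (whileFuel cond body k s).expect g := fun s => wp_whileLoop s _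
  have hmono : ∀ s, Monotone fun k => (whileFuel cond body k s).expect g :=
    fun s => monotone_wp_whileFuel s _
  simp only [expect_eq_iSup]
  rw [← (hmono s).iSup_nat_add 1]
  split_ifs with hc
  · rw [expect_iSup _ hmono]
    exact iSup_congr fun k => (expect_whileFuel_succ k s g).trans (if_pos hc)
  · simp only [expect_whileFuel_succ, hc, Bool.false_eq_true, if_false, ciSup_const]

theorem expect_whileFuel_le {V g : σ → ℝ≥0∞}
    (hbody : ∀ s, cond s = true → (body s).expect V ≤ V s)
    (hexit : ∀ s, cond s = false → g s ≤ V s) (k : ℕ) (s : σ) :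
    (whileFuel cond body k s).expect g ≤ V s := by
  induction k generalizing s with
  | zero => exact (wp_whileFuel_zero s _).trans_le zero_le
  | succ k ih =>
    rw [expect_whileFuel_succ]
    split_ifs with hc
    · exact (expect_mono ih).trans (hbody s hc)
    · exact hexit s (by simpa using hc)

theorem expect_whileLoop_le {V g : σ → ℝ≥0∞}
    (hbody : ∀ s, cond s = true → (body s).expect V ≤ V s)
    (hexit : ∀ s, cond s = false → g s ≤ V s) (s : σ) :
    (whileLoop cond body s).expect g ≤ V s :=
  (wp_whileLoop s _).trans_le (iSup_le fun k => expect_whileFuel_le hbody hexit k s)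

theorem haltProb_whileFuel_le_one (hb : ∀ s, (body s).haltProb ≤ 1) (k : ℕ) (s : σ) :
    (whileFuel cond body k s).haltProb ≤ 1 :=
  expect_whileFuel_le (V := fun _ => 1) (fun s _ => hb s) (fun _ _ => le_rfl) k s

theorem haltProb_whileLoop_le_one (hb : ∀ s, (body s).haltProb ≤ 1) (s : σ) :
    (whileLoop cond body s).haltProb ≤ 1 :=
  expect_whileLoop_le (V := fun _ => 1) (fun s _ => hb s) (fun _ _ => le_rfl) s

theorem haltProb_whileLoop_eq_one (hb : ∀ s, (body s).haltProb = 1) {δ : ℝ≥0∞} (hδ : δ ≠ 0)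
    (hexit : ∀ s, cond s = true → δ ≤ (body s).expect fun s' => if cond s' then 0 else 1) (s : σ) :
    (whileLoop cond body s).haltProb = 1 := by
  have h_le : ∀ s, (whileLoop cond body s).haltProb ≤ 1 :=
    haltProb_whileLoop_le_one fun s => (hb s).le
  have unroll := fun s => expect_whileLoop (cond := cond) (body := body) s fun _ => 1
  set m := ⨅ s, (whileLoop cond body s).haltProb
  have hm_le : ∀ s, m ≤ (whileLoop cond body s).haltProb := iInf_le _
  have hm_one : m ≤ 1 := (hm_le s).trans (h_le s)
  -- The infimum `m` of the halting probabilities gains `(1 - m) * δ` in one round, hence `m = 1`.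
  have gain : ∀ s, cond s = true → m + (1 - m) * δ ≤ (whileLoop cond body s).haltProb := by
    intro s hs
    calc m + (1 - m) * δ
        ≤ (body s).expect fun s' => m + (1 - m) * if cond s' then 0 else 1 := by
          rw [expect_add, expect_const, hb, mul_one, expect_const_mul]
          gcongr
          exact hexit s hs
      _ ≤ (body s).expect fun s' => (whileLoop cond body s').haltProb := by
          refine expect_mono fun s' => ?_
          split_ifs with hs'
          · simpa using hm_le s'
          · rw [mul_one, add_tsub_cancel_of_le hm_one, haltProb, unroll, if_neg hs']
      _ = _ := ((unroll s).trans (if_pos hs)).symm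
  refine (h_le s).antisymm ?_
  by_cases hs : cond s = true
  · have hδ_one : δ ≤ 1 := (hexit s hs).trans
      (expect_le_of_le (hb s).le fun s' => by split_ifs <;> simp)
    have gain_inf : m + (1 - m) * δ ≤ m + 0 := by
      rw [add_zero]
      refine le_iInf fun s' => ?_
      by_cases hs' : cond s' = true
      · exact gain s' hs'
      · rw [haltProb, unroll, if_neg hs']
        exact (add_le_add_right (mul_le_of_le_one_right' hδ_one) m).trans_eq
          (add_tsub_cancel_of_le hm_one)
    have hm_top : m ≠ ∞ := ne_top_of_le_ne_top ENNReal.one_ne_top hm_one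
    have h0 := le_zero_iff.1 ((ENNReal.add_le_add_iff_left hm_top).1 gain_inf)
    exact (tsub_eq_zero_iff_le.1 ((mul_eq_zero.1 h0).resolve_right hδ)).trans (hm_le s)
  · rw [haltProb, unroll, if_neg hs]

theorem expectedCost_whileFuel_succ_le (hb : ∀ s, (body s).haltProb ≤ 1) (k : ℕ) (s : σ) :
    (whileFuel cond body (k + 1) s).expectedCost ≤ 1 + if cond s then
      (body s).expectedCost + (body s).expect fun s' => (whileFuel cond body k s').expectedCost
    else 0 := by
  rw [whileFuel_succ_eq, ← Nat.cast_one (R := ℝ≥0∞)]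
  have hk := haltProb_whileFuel_le_one (cond := cond) hb k
  split_ifs
  · exact (expectedCost_tick_bind_le 1 _ (haltProb_bind_le_one (hb s) hk)).trans
      (add_le_add_right (expectedCost_bind_le _ _ hk) _)
  · exact (expectedCost_tick_bind_le 1 _ (haltProb_pure s).le).trans_eq
      (congrArg _ (expectedCost_pure s))

theorem expectedCost_whileLoop (s : σ) :
    (whileLoop cond body s).expectedCost = ⨆ k, (whileFuel cond body k s).expectedCost :=
  wp_whileLoop s fun _ c => (c : ℝ≥0∞)

theorem expectedCost_whileFuel_add_expect_le (hb : ∀ s, (body s).haltProb ≤ 1) {V g : σ → ℝ≥0∞}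
    (hV : ∀ s, 1 + (if cond s then (body s).expectedCost + (body s).expect V else g s) ≤ V s)
    (k : ℕ) (s : σ) :
    (whileFuel cond body k s).expectedCost + (whileFuel cond body k s).expect g ≤ V s := by
  induction k generalizing s with
  | zero =>
    rw [expectedCost_eq_wp, expect, wp_whileFuel_zero, wp_whileFuel_zero, add_zero]
    exact zero_le
  | succ k ih =>
    refine (add_le_add_left (expectedCost_whileFuel_succ_le hb k s) _).trans (le_trans ?_ (hV s))
    rw [expect_whileFuel_succ, add_assoc]
    split_ifs
    · rw [add_assoc, ← expect_add]
      exact add_le_add_right (add_le_add_right (expect_mono ih) _) _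
    · rw [zero_add]

theorem expectedCost_whileLoop_add_expect_le (hb : ∀ s, (body s).haltProb ≤ 1) {V g : σ → ℝ≥0∞}
    (hV : ∀ s, 1 + (if cond s then (body s).expectedCost + (body s).expect V else g s) ≤ V s)
    (s : σ) : (whileLoop cond body s).expectedCost + (whileLoop cond body s).expect g ≤ V s := by
  rw [expectedCost_eq_wp, expect, ← wp_add, wp_whileLoop]
  refine iSup_le fun k => ?_
  rw [wp_add]
  exact expectedCost_whileFuel_add_expect_le hb hV k s

end WhileLoop

/-! ### Coupled programs -/

/-- Two programs have equal laws up to the relation `R` between their results. This is a coupling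
stated without a joint law: tests that agree on `R`-related results have equal expectations. -/
def Coupled (R : α → β → Prop) (p : RandProg α) (q : RandProg β) : Prop :=
  ∀ g g', (∀ a b, R a b → ∀ k, g a k = g' b k) → p.wp g = q.wp g'

theorem Coupled.mono {R R' : α → β → Prop} {p : RandProg α} {q : RandProg β}
    (h : Coupled R p q) (hR : ∀ a b, R a b → R' a b) : Coupled R' p q :=
  fun g g' hg => h g g' fun a b hab => hg a b (hR a b hab)

theorem Coupled.pure {R : α → β → Prop} {a : α} {b : β} (h : R a b) :
    Coupled R (Pure.pure a : RandProg α) (Pure.pure b : RandProg β) := fun g g' hg => by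
  rw [wp_pure, wp_pure, hg a b h]

theorem Coupled.bind {α' β' : Type} {R : α → β → Prop} {R' : α' → β' → Prop} {p : RandProg α}
    {q : RandProg β} {f : α → RandProg α'} {f' : β → RandProg β'} (h : Coupled R p q)
    (hf : ∀ a b, R a b → Coupled R' (f a) (f' b)) : Coupled R' (p >>= f) (q >>= f') :=
  fun g g' hg => by
    rw [wp_bind, wp_bind]
    exact h _ _ fun a b hab k => hf a b hab _ _ fun a' b' hab' l => hg a' b' hab' _

theorem Coupled.bind_left {α' β' : Type} {R : α' → β' → Prop} (p : RandProg α)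
    {f : α → RandProg α'} {f' : α → RandProg β'} (hf : ∀ a, Coupled R (f a) (f' a)) :
    Coupled R (p >>= f) (p >>= f') := fun g g' hg => by
  rw [wp_bind, wp_bind]
  exact congrArg p.wp (funext fun a => funext fun k => hf a _ _ fun a' b' hab _ => hg a' b' hab _)

theorem Coupled.whileLoop {R : σ → σ → Prop} {cond : σ → Bool} {body : σ → RandProg σ}
    (hc : ∀ s t, R s t → cond s = cond t)
    (hb : ∀ s t, R s t → cond s = true → Coupled R (body s) (body t)) {s t : σ} (h : R s t) :
    Coupled (fun a b => R a b ∧ cond a = false)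
      (whileLoop cond body s) (whileLoop cond body t) := by
  have coupled_whileFuel : ∀ k s t, R s t → Coupled (fun a b => R a b ∧ cond a = false)
      (whileFuel cond body k s) (whileFuel cond body k t) := by
    intro k
    induction k with
    | zero =>
      intro s t _ g g' _
      rw [wp_whileFuel_zero, wp_whileFuel_zero]
    | succ k ih =>
      intro s t hst g g' hg
      rw [wp_whileFuel_succ, wp_whileFuel_succ, ← hc s t hst]
      split_ifs with hcs
      · exact hb s t hst hcs _ _ fun a b hab c => ih a b hab _ _ fun a' b' h' l => hg a' b' h' _
      · exact hg s t ⟨hst, by simpa using hcs⟩ 1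
  intro g g' hg
  rw [wp_whileLoop, wp_whileLoop]
  exact iSup_congr fun k => coupled_whileFuel k s t h g g' hg

end RandProg

/-! ### Pointer maps -/

/-- A set of arcs with at most one arc leaving each node: `f a = some b` is the arc `a → b`, and
`f a = none` says that no arc leaves `a`, i.e. that `a` is a root. -/
abbrev PointerMap (α : Type*) := α → Option α

namespace PointerMap

variable {α : Type*} {f f' : PointerMap α} {A S : Set α} {a b c i j r u u' v : α}

/-- `RootOf f a r`: the pointers starting from `a` end at the root `r`. -/
inductive RootOf (f : PointerMap α) : α → α → Prop
  | root {a : α} : f a = none → RootOf f a a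
  | step {a b r : α} : f a = some b → RootOf f b r → RootOf f a r

/-- `Leads f a b`: the pointers starting from `a` pass through `b` (possibly `b = a`). -/
def Leads (f : PointerMap α) : α → α → Prop :=
  Relation.ReflTransGen fun a b => f a = some b

/-- All pointers end at a root; on a finite set this excludes exactly the cycles. -/
def Acyclic (f : PointerMap α) : Prop := ∀ a, ∃ r, RootOf f a r

/-- The nodes met by following the pointers from the nodes in `S`. -/
def Reached (f : PointerMap α) (S : Set α) : Set α := {x | ∃ j ∈ S, Leads f j x}

/-- `PathAvoiding A f u a`: the pointers starting from `a` meet `u`, and do not meet `A` before. -/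
inductive PathAvoiding (A : Set α) (f : PointerMap α) (u : α) : α → Prop
  | refl : PathAvoiding A f u u
  | step {a b : α} : a ≠ u → a ∉ A → f a = some b → PathAvoiding A f u b → PathAvoiding A f u a

theorem RootOf.eq_none (h : RootOf f a r) : f r = none := by
  induction h with
  | root h => exact h
  | step _ _ ih => exact ih

theorem RootOf.leads (h : RootOf f a r) : Leads f a r := by
  induction h with
  | root _ => exact .refl
  | step h _ ih => exact .head h ih

theorem RootOf.of_leads (hab : Leads f a b) (h : RootOf f b r) : RootOf f a r := by
  induction hab using Relation.ReflTransGen.head_induction_on with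
  | refl => exact h
  | head h1 _ ih => exact .step h1 ih

theorem RootOf.next (h : RootOf f a r) (hb : f a = some b) : RootOf f b r := by
  cases h with
  | root h => simp [h] at hb
  | step h1 h2 =>
    rw [h1, Option.some.injEq] at hb
    exact hb ▸ h2

theorem RootOf.of_leads_left (h : RootOf f a r) (hab : Leads f a b) : RootOf f b r := by
  induction hab using Relation.ReflTransGen.head_induction_on with
  | refl => exact h
  | head h1 _ ih => exact ih (h.next h1)

theorem rootOf_iff_of_leads (h : Leads f a b) : RootOf f a r ↔ RootOf f b r :=
  ⟨fun hr => hr.of_leads_left h, .of_leads h⟩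

theorem RootOf.unique {r' : α} (h : RootOf f a r) (h' : RootOf f a r') : r = r' := by
  induction h with
  | root h =>
    cases h' with
    | root _ => rfl
    | step h1 _ => simp [h] at h1
  | step h _ ih => exact ih (h'.next h)

theorem leads_iff (h : f a = some b) : Leads f a c ↔ a = c ∨ Leads f b c := by
  simp [Leads, Relation.ReflTransGen.cases_head_iff (a := a), h]

theorem leads_iff_of_eq_none (h : f a = none) : Leads f a b ↔ a = b := by
  simp [Leads, Relation.ReflTransGen.cases_head_iff (a := a), h]

theorem leads_total (hb : Leads f a b) (hc : Leads f a c) : Leads f b c ∨ Leads f c b :=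
  Relation.ReflTransGen.total_of_right_unique
    (fun _ _ _ h h' => Option.some.inj (h.symm.trans h')) hb hc

theorem RootOf.not_leads (h : RootOf f a r) (hb : f a = some b) : ¬ Leads f b a := by
  induction h generalizing b with
  | root h => simp [h] at hb
  | @step a c _ hc _ ih =>
    obtain rfl : c = b := by simpa [hc] using hb
    intro hca
    rcases hca.cases_head with rfl | ⟨d, hd, hda⟩
    · exact ih hc .refl
    · exact ih hd (hda.tail hc)

theorem Acyclic.not_leads (hf : Acyclic f) (h : f a = some b) : ¬ Leads f b a :=
  (hf a).choose_spec.not_leads h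

theorem acyclic_none : Acyclic (fun _ : α => none) := fun a => ⟨a, .root rfl⟩

theorem Leads.congr (hab : Leads f a b) (h : ∀ x, Leads f a x → f' x = f x) : Leads f' a b := by
  induction hab using Relation.ReflTransGen.head_induction_on with
  | refl => exact .refl
  | @head a c h1 _ ih => exact .head ((h a .refl).trans h1) (ih fun x hx => h x (.head h1 hx))

theorem RootOf.congr (har : RootOf f a r) (h : ∀ x, Leads f a x → f' x = f x) : RootOf f' a r :=
  .of_leads (har.leads.congr h) (.root ((h r har.leads).trans har.eq_none))

theorem Acyclic.of_forall_ne (hf : Acyclic f) (h : ∀ x, x ≠ u → f' x = f x)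
    (hu : ∃ r, RootOf f' u r) : Acyclic f' := by
  intro a
  obtain ⟨r, hr⟩ := hf a
  induction hr with
  | @root a ha =>
    by_cases hau : a = u
    · exact hau ▸ hu
    · exact ⟨a, .root ((h a hau).trans ha)⟩
  | @step a b _ hab _ ih =>
    by_cases hau : a = u
    · exact hau ▸ hu
    · exact ih.imp fun _ => .step ((h a hau).trans hab)

theorem PathAvoiding.leads (h : PathAvoiding A f u a) : Leads f a u := by
  induction h with
  | refl => exact .refl
  | step _ _ h _ ih => exact .head h ih

theorem PathAvoiding.mono {B : Set α} (h : PathAvoiding A f u a) (hBA : B ⊆ A) :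
    PathAvoiding B f u a := by
  induction h with
  | refl => exact .refl
  | step h1 h2 h3 _ ih => exact .step h1 (fun hB => h2 (hBA hB)) h3 ih

theorem PathAvoiding.congr (h : PathAvoiding A f u a) (hf : ∀ x, x ≠ u → x ∉ A → f' x = f x) :
    PathAvoiding A f' u a := by
  induction h with
  | refl => exact .refl
  | step h1 h2 h3 _ ih => exact .step h1 h2 ((hf _ h1 h2).trans h3) ih

theorem PathAvoiding.extend (h : PathAvoiding A f u a) (hu : u ∉ A) (huv : f u = some v) :
    PathAvoiding A f v a := by
  induction h with
  | refl =>
    by_cases h : u = v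
    · exact h ▸ .refl
    · exact .step h hu huv .refl
  | @step a b _ h2 h3 _ ih =>
    by_cases h : a = v
    · exact h ▸ .refl
    · exact .step h h2 h3 ih

theorem PathAvoiding.end_unique (h : PathAvoiding A f u a) (h' : PathAvoiding A f u' a)
    (hu : u ∈ A ∨ f u = none) (hu' : u' ∈ A ∨ f u' = none) : u = u' := by
  have no_step : ∀ {x y}, x ∈ A ∨ f x = none → x ∉ A → f x ≠ some y := by
    rintro x y (hx | hx) hxA
    · exact absurd hx hxA
    · simp [hx]
  induction h with
  | refl =>
    cases h' with
    | refl => rfl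
    | step _ hA hb _ => exact absurd hb (no_step hu hA)
  | step _ hA hb _ ih =>
    cases h' with
    | refl => exact absurd hb (no_step hu' hA)
    | step _ _ hb' h4 =>
      rw [hb, Option.some.injEq] at hb'
      exact ih (hb' ▸ h4)

theorem Leads.exists_pathAvoiding (h : Leads f a b) (hb : b ∈ A) :
    ∃ d ∈ A, PathAvoiding A f d a := by
  induction h using Relation.ReflTransGen.head_induction_on with
  | refl => exact ⟨b, hb, .refl⟩
  | @head a c hac _ ih =>
    by_cases ha : a ∈ A
    · exact ⟨a, ha, .refl⟩
    · obtain ⟨d, hd, hcd⟩ := ih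
      exact ⟨d, hd, .step (ne_of_mem_of_not_mem hd ha).symm ha hac hcd⟩

theorem RootOf.exists_pathAvoiding (h : RootOf f a r) (A : Set α) :
    ∃ u, PathAvoiding A f u a ∧ (u ∈ A ∨ f u = none) := by
  obtain ⟨u, hu, hp⟩ := h.leads.exists_pathAvoiding (A := A ∪ {x | f x = none}) (.inr h.eq_none)
  exact ⟨u, hp.mono Set.subset_union_left, hu⟩

theorem subset_reached (f : PointerMap α) (S : Set α) : S ⊆ Reached f S :=
  fun j hj => ⟨j, hj, .refl⟩

theorem Leads.mem_reached (h : Leads f a b) (ha : a ∈ Reached f S) : b ∈ Reached f S := by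
  obtain ⟨j, hj, hja⟩ := ha
  exact ⟨j, hj, hja.trans h⟩

theorem mem_reached_insert : a ∈ Reached f (insert i S) ↔ a ∈ Reached f S ∨ Leads f i a := by
  simp [Reached, or_comm]

theorem reached_empty (f : PointerMap α) : Reached f ∅ = ∅ := by
  simp [Reached]

open scoped Classical in
/-- The root at which the pointers starting from `a` end, or `none` if they run into a cycle. -/
noncomputable def rootOf (f : PointerMap α) (a : α) : Option α :=
  if h : ∃ r, RootOf f a r then some h.choose else none

theorem rootOf_eq_some (h : RootOf f a r) : rootOf f a = some r := by
  have h' : ∃ r, RootOf f a r := ⟨r, h⟩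
  rw [rootOf, dif_pos h', Option.some.injEq]
  exact h'.choose_spec.unique h

theorem rootOf_congr (h : ∀ r, RootOf f a r ↔ RootOf f' b r) : rootOf f a = rootOf f' b := by
  unfold rootOf
  congr! 3
  · exact funext fun r => propext (h r)
  · exact h _

theorem rootOf_eq_of_leads (h : Leads f a b) : rootOf f a = rootOf f b :=
  rootOf_congr fun _ => rootOf_iff_of_leads h

section Update

variable [DecidableEq α]

theorem PathAvoiding.leads_update (h : PathAvoiding A f u a) (hb : b ∈ A) (c : Option α) :
    Leads (Function.update f b c) a u :=
  (h.congr fun _ _ hx => Function.update_of_ne (ne_of_mem_of_not_mem hb hx).symm _ _).leads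

theorem Acyclic.update_none (hf : Acyclic f) (u : α) : Acyclic (Function.update f u none) :=
  hf.of_forall_ne (fun _ hx => Function.update_of_ne hx _ _) ⟨u, .root (by simp)⟩

theorem Acyclic.update_some (hf : Acyclic f) (h : ¬ Leads f v u) :
    Acyclic (Function.update f u (some v)) := by
  obtain ⟨r, hr⟩ := hf v
  refine hf.of_forall_ne (fun _ hx => Function.update_of_ne hx _ _)
    ⟨r, .step (b := v) (by simp) (hr.congr fun x hx => Function.update_of_ne ?_ _ _)⟩
  rintro rfl
  exact h hx

theorem Acyclic.cut_next (hf : Acyclic (Function.update f u none)) (huv : f u = some v) :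
    Acyclic (Function.update f v none) := by
  have hv : RootOf (Function.update f v none) v v := .root (by simp)
  refine (hf.update_none v).of_forall_ne (u := u) (fun x hx => ?_) ⟨v, ?_⟩
  · by_cases h : x = v
    · simp [h]
    · simp [hx, h]
  · by_cases h : u = v
    · exact h ▸ hv
    · exact .step (by rw [Function.update_of_ne h, huv]) hv

theorem reached_update (hu : u ∉ Reached f S) (c : Option α) :
    Reached (Function.update f u c) S = Reached f S := by
  have h_off : ∀ x ∈ Reached f S, Function.update f u c x = f x := fun x hx =>
    Function.update_of_ne (ne_of_mem_of_not_mem hx hu) _ _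
  ext x
  constructor
  · rintro ⟨j, hj, hx⟩
    induction hx with
    | refl => exact subset_reached f S hj
    | @tail b d _ hbd ih => exact Leads.mem_reached (.single ((h_off b ih).symm.trans hbd)) ih
  · rintro ⟨j, hj, hx⟩
    exact ⟨j, hj, hx.congr fun y hy => h_off y ⟨j, hj, hy⟩⟩

theorem Acyclic.of_update_none (hf : Acyclic (Function.update f u none)) (hu : u ∉ Reached f S)
    (hv : v ∈ Reached f S) (huv : f u = some v) : Acyclic f := by
  have hvu : ¬ Leads (Function.update f u none) v u := fun hl => by
    have hS := reached_update hu none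
    exact hu (hS ▸ hl.mem_reached (hS.symm ▸ hv))
  simpa [← huv] using hf.update_some hvu

theorem RootOf.update (hr : RootOf f a r) (hu : u ∉ Reached f S) (ha : a ∈ Reached f S)
    (c : Option α) : RootOf (Function.update f u c) a r :=
  hr.congr fun _ hx => Function.update_of_ne (ne_of_mem_of_not_mem (hx.mem_reached ha) hu) _ _

theorem rootOf_update (hu : u ∉ Reached f S) (ha : a ∈ Reached f S) (c : Option α) :
    rootOf (Function.update f u c) a = rootOf f a := by
  refine rootOf_congr fun r => ⟨fun hr => ?_, fun hr => hr.update hu ha c⟩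
  have hS := reached_update hu c
  have h := hr.update (hS.symm ▸ hu) (hS.symm ▸ ha) (f u)
  rwa [Function.update_idem, Function.update_eq_self] at h

/-- Redirecting the pointer of `i` to `c` would make `j` the root of `i`. -/
def RootVia (f : PointerMap α) (i j : α) (c : Option α) : Prop :=
  c.elim (i = j) fun k => RootOf f k j

theorem rootOf_update_self_iff {c : Option α} (hf : Acyclic (Function.update f i c)) :
    RootOf (Function.update f i c) i j ↔ RootVia f i j c := by
  cases c with
  | none =>
    refine ⟨fun h => (leads_iff_of_eq_none (by simp)).1 h.leads, ?_⟩
    rintro rfl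
    exact .root (by simp)
  | some k =>
    have hne : ∀ {x}, Leads (Function.update f i (some k)) k x → x ≠ i := by
      rintro _ hl rfl
      exact hf.not_leads (by simp) hl
    have h_off : ∀ x, Leads (Function.update f i (some k)) k x →
        f x = Function.update f i (some k) x :=
      fun x hx => (Function.update_of_ne (hne hx) _ _).symm
    refine ⟨fun h => (h.next (by simp)).congr h_off, fun h => ?_⟩
    obtain ⟨r, hr⟩ := hf k
    obtain rfl := (hr.congr h_off).unique h
    exact .step (by simp) hr

theorem rootOf_iff_rootVia {c : Option α} (hf : Acyclic f)
    (hc : ¬ Acyclic (Function.update f i c)) : RootOf f i j ↔ RootVia f i j c := by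
  cases c with
  | none => exact absurd (hf.update_none i) hc
  | some k => exact (rootOf_iff_of_leads (not_not.1 fun hl => hc (hf.update_some hl))).symm

open scoped Classical in
/-- Exchange the pointer of `i` with another choice for it, unless this creates a cycle. -/
noncomputable def exchange (i : α) (p : PointerMap α × Option α) : PointerMap α × Option α :=
  if Acyclic (Function.update p.1 i p.2) then (Function.update p.1 i p.2, p.1 i) else p

theorem acyclic_exchange {p : PointerMap α × Option α} (hp : Acyclic p.1) (i : α) :
    Acyclic (exchange i p).1 := by
  unfold exchange
  split_ifs with h
  exacts [h, hp]

theorem exchange_exchange {p : PointerMap α × Option α} (hp : Acyclic p.1) (i : α) :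
    exchange i (exchange i p) = p := by
  by_cases h : Acyclic (Function.update p.1 i p.2) <;> simp [exchange, h, hp]

theorem rootVia_exchange_iff {p : PointerMap α × Option α} (hp : Acyclic p.1) :
    RootVia (exchange i p).1 i j (exchange i p).2 ↔ RootOf p.1 i j := by
  unfold exchange
  split_ifs with h
  · have h' : Function.update (Function.update p.1 i p.2) i (p.1 i) = p.1 := by simp
    rw [← rootOf_update_self_iff (h'.symm ▸ hp), h']
  · exact (rootOf_iff_rootVia hp h).symm

theorem rootOf_exchange_iff {p : PointerMap α × Option α} (hp : Acyclic p.1) :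
    RootOf (exchange i p).1 i j ↔ RootVia p.1 i j p.2 := by
  rw [← rootVia_exchange_iff (acyclic_exchange hp i), exchange_exchange hp]

/-- The first of `u` and `u'` met from `v` lies on a cycle that the other's cut leaves intact. -/
theorem eq_of_next_eq (hu : Acyclic (Function.update f u none))
    (hu' : Acyclic (Function.update f u' none)) (hi : Leads f i u) (hi' : Leads f i u')
    (hv : f u = some v) (hv' : f u' = some v) : u = u' := by
  by_contra hne
  have hl : ∃ x ∈ ({u, u'} : Set α), Leads f v x := by
    rcases leads_total hi hi' with h | h
    · exact ⟨u', by simp, ((leads_iff hv).1 h).resolve_left hne⟩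
    · exact ⟨u, by simp, ((leads_iff hv').1 h).resolve_left (Ne.symm hne)⟩
  obtain ⟨x, hx, hvx⟩ := hl
  obtain ⟨d, rfl | rfl, hd⟩ := hvx.exists_pathAvoiding hx
  · exact hu'.not_leads (by rw [Function.update_of_ne hne, hv]) (hd.leads_update (by simp) none)
  · exact hu.not_leads (by rw [Function.update_of_ne (Ne.symm hne), hv'])
      (hd.leads_update (by simp) none)

end Update

end PointerMap

/-- Exchanging the value of `f` at `u` with the second summation variable is an involution. -/
theorem sum_sum_swap_update {ι κ M : Type*} [Fintype ι] [DecidableEq ι] [Fintype κ]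
    [AddCommMonoid M] (u : ι) (Ψ : (ι → κ) → κ → M) :
    ∑ f, ∑ c, Ψ f c = ∑ f : ι → κ, ∑ c, Ψ (Function.update f u c) (f u) := by
  have hinv : Function.Involutive fun p : (ι → κ) × κ => (Function.update p.1 u p.2, p.1 u) :=
    fun p => by simp
  calc ∑ f, ∑ c, Ψ f c = ∑ p : (ι → κ) × κ, Ψ p.1 p.2 := (Fintype.sum_prod_type' Ψ).symm
    _ = ∑ p : (ι → κ) × κ, Ψ (Function.update p.1 u p.2) (p.1 u) :=
      (Equiv.sum_comp hinv.toPerm fun p => Ψ p.1 p.2).symm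
    _ = _ := Fintype.sum_prod_type _

namespace WeightedDigraph

open PointerMap

variable {n : ℕ}

/-! ### In-forests as acyclic pointer maps -/

/-- The set of arcs given by a pointer map. -/
def pointerArcs (f : PointerMap (Fin n)) : Finset (Fin n × Fin n) :=
  Finset.univ.filter fun e => f e.1 = some e.2

section PointerArcs

variable {f : PointerMap (Fin n)} {i j r : Fin n}

theorem mem_pointerArcs {e : Fin n × Fin n} : e ∈ pointerArcs f ↔ f e.1 = some e.2 := by
  simp [pointerArcs]

theorem pointerArcs_injective :
    Function.Injective (pointerArcs : PointerMap (Fin n) → Finset (Fin n × Fin n)) := by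
  intro f g h
  funext a
  refine Option.ext fun b => ?_
  simpa [mem_pointerArcs] using congrArg (fun F => (a, b) ∈ F) h

theorem outCount_pointerArcs (f : PointerMap (Fin n)) (v : Fin n) :
    outCount (pointerArcs f) v = if f v = none then 0 else 1 := by
  unfold outCount
  cases hv : f v with
  | none =>
    rw [if_pos rfl, Finset.card_eq_zero, Finset.filter_eq_empty_iff]
    rintro e he rfl
    simp [mem_pointerArcs, hv] at he
  | some b =>
    rw [if_neg (by simp), Finset.card_eq_one]
    refine ⟨(v, b), ?_⟩
    ext ⟨x, y⟩
    simp only [Finset.mem_filter, mem_pointerArcs, Finset.mem_singleton, Prod.mk.injEq]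
    constructor
    · rintro ⟨h1, rfl⟩
      exact ⟨rfl, (Option.some.inj (hv.symm.trans h1)).symm⟩
    · rintro ⟨rfl, rfl⟩
      exact ⟨hv, rfl⟩

theorem SameComponent.rootOf_iff (h : SameComponent (pointerArcs f) i j) :
    RootOf f i r ↔ RootOf f j r := by
  induction h with
  | rel a b h => exact rootOf_iff_of_leads (.single (mem_pointerArcs.1 h))
  | refl a => rfl
  | symm a b _ ih => exact ih.symm
  | trans a b c _ _ ih1 ih2 => exact ih1.trans ih2

theorem sameComponent_of_leads (h : Leads f i j) : SameComponent (pointerArcs f) i j := by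
  induction h with
  | refl => exact .refl _
  | tail _ h ih => exact .trans _ _ _ ih (.rel _ _ (mem_pointerArcs.2 h))

theorem rootOf_iff_sameComponent :
    RootOf f i j ↔ SameComponent (pointerArcs f) i j ∧ outCount (pointerArcs f) j = 0 := by
  rw [outCount_pointerArcs]
  constructor
  · intro h
    exact ⟨sameComponent_of_leads h.leads, if_pos h.eq_none⟩
  · rintro ⟨h1, h2⟩
    exact h1.rootOf_iff.2 (.root (by simpa using h2))

theorem isInForest_pointerArcs (G : WeightedDigraph n) :
    G.IsInForest (pointerArcs f) ↔ pointerArcs f ⊆ G.arcs ∧ Acyclic f := by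
  refine and_congr_right fun _ => ?_
  constructor
  · intro h i
    obtain ⟨r, h1, h2, _⟩ := h i
    exact ⟨r, rootOf_iff_sameComponent.2 ⟨h1, h2⟩⟩
  · intro h i
    obtain ⟨r, hr⟩ := h i
    obtain ⟨h1, h2⟩ := rootOf_iff_sameComponent.1 hr
    refine ⟨r, h1, h2, fun v hv hvr => ?_⟩
    rw [outCount_pointerArcs, if_neg]
    intro hn
    exact hvr ((hv.rootOf_iff.2 (.root hn)).unique hr)

theorem exists_pointerArcs_eq {F : Finset (Fin n × Fin n)} (hF : ∀ v, outCount F v ≤ 1) :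
    ∃ f, pointerArcs f = F := by
  classical
  refine ⟨fun v => if hv : ∃ b, (v, b) ∈ F then some hv.choose else none, ?_⟩
  ext ⟨v, b⟩
  rw [mem_pointerArcs]
  by_cases hv : ∃ b, (v, b) ∈ F
  · simp only [dif_pos hv, Option.some.injEq]
    refine ⟨fun h => h ▸ hv.choose_spec, fun h => ?_⟩
    have := Finset.card_le_one.1 (hF v) (v, hv.choose)
      (Finset.mem_filter.2 ⟨hv.choose_spec, rfl⟩) (v, b) (Finset.mem_filter.2 ⟨h, rfl⟩)
    exact (Prod.mk.inj this).2
  · simpa [dif_neg hv] using fun h => hv ⟨b, h⟩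

theorem IsInForest.exists_pointerArcs_eq {G : WeightedDigraph n} {F : Finset (Fin n × Fin n)}
    (h : G.IsInForest F) : ∃ f, pointerArcs f = F := by
  refine WeightedDigraph.exists_pointerArcs_eq fun v => ?_
  obtain ⟨r, _, hr, hne⟩ := h.2 v
  by_cases hv : v = r
  · exact (hv ▸ hr).trans_le zero_le_one
  · exact (hne v (.refl _) hv).le

theorem pointerArcs_mem_inForests (G : WeightedDigraph n) :
    pointerArcs f ∈ G.inForests ↔ pointerArcs f ⊆ G.arcs ∧ Acyclic f := by
  simp only [inForests, Finset.mem_filter, Finset.mem_powerset, isInForest_pointerArcs]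
  tauto

theorem pointerArcs_mem_inForestsRootedAt (G : WeightedDigraph n) :
    pointerArcs f ∈ G.inForestsRootedAt i j ↔
      (pointerArcs f ⊆ G.arcs ∧ Acyclic f) ∧ RootOf f i j := by
  simp only [inForestsRootedAt, Finset.mem_filter, pointerArcs_mem_inForests,
    rootOf_iff_sameComponent]

theorem sum_eq_sum_pointerArcs {M : Type*} [AddCommMonoid M] (Ψ : Finset (Fin n × Fin n) → M)
    (h : ∀ F, Ψ F ≠ 0 → ∃ f, pointerArcs f = F) : ∑ F, Ψ F = ∑ f, Ψ (pointerArcs f) := by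
  rw [← Finset.sum_image (g := pointerArcs) (f := Ψ) pointerArcs_injective.injOn]
  refine (Finset.sum_subset (Finset.subset_univ _) fun F _ hF => ?_).symm
  by_contra hne
  obtain ⟨f, rfl⟩ := h F hne
  exact hF (Finset.mem_image_of_mem _ (Finset.mem_univ _))

end PointerArcs

/-! ### The forest law on pointer maps -/

variable (G : WeightedDigraph n)

theorem deg_nonneg (u : Fin n) : 0 ≤ G.deg u := Finset.sum_nonneg fun v _ => G.w_nonneg u v

theorem one_add_deg_pos (u : Fin n) : 0 < 1 + G.deg u := by linarith [G.deg_nonneg u]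

theorem deg_le_sum_deg (u : Fin n) : G.deg u ≤ ∑ v, G.deg v :=
  Finset.single_le_sum (fun v _ => G.deg_nonneg v) (Finset.mem_univ u)

/-- The weight of the choice `c` for the pointer of `u`; being a root has weight `1`. -/
def pointerWeight (u : Fin n) (c : Option (Fin n)) : ℝ := c.elim 1 (G.w u)

/-- The weight of a pointer map: the product of its arc weights. -/
def mapWeight (f : PointerMap (Fin n)) : ℝ := ∏ a, G.pointerWeight a (f a)

open scoped Classical in
/-- The total weight of the acyclic pointer maps. -/
noncomputable def partitionFunction : ℝ := ∑ f with Acyclic f, G.mapWeight f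

/-- The weight of a pointer map relative to the total weight of the acyclic ones. For acyclic maps
it is the probability of the corresponding in-forest; walks in progress pass through maps with a
cycle, for which it is meaningful too. -/
noncomputable def density (f : PointerMap (Fin n)) : ℝ := G.mapWeight f / G.partitionFunction

theorem pointerWeight_nonneg (u : Fin n) (c : Option (Fin n)) : 0 ≤ G.pointerWeight u c := by
  cases c with
  | none => exact zero_le_one
  | some v => exact G.w_nonneg u v

theorem sum_pointerWeight (u : Fin n) : ∑ c, G.pointerWeight u c = 1 + G.deg u :=
  Fintype.sum_option _

theorem mapWeight_nonneg (f : PointerMap (Fin n)) : 0 ≤ G.mapWeight f :=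
  Finset.prod_nonneg fun _ _ => G.pointerWeight_nonneg _ _

theorem partitionFunction_pos : 0 < G.partitionFunction := by
  refine Finset.sum_pos' (fun f _ => G.mapWeight_nonneg f) ⟨fun _ => none, ?_, ?_⟩
  · simpa using acyclic_none
  · simp [mapWeight, pointerWeight]

theorem density_nonneg (f : PointerMap (Fin n)) : 0 ≤ G.density f :=
  div_nonneg (G.mapWeight_nonneg f) G.partitionFunction_pos.le

theorem mapWeight_mul_pointerWeight (f : PointerMap (Fin n)) (u : Fin n) (c : Option (Fin n)) :
    G.mapWeight f * G.pointerWeight u c =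
      G.mapWeight (Function.update f u c) * G.pointerWeight u (f u) := by
  have h : ∀ f : PointerMap (Fin n), G.mapWeight f =
      G.pointerWeight u (f u) * ∏ a ∈ Finset.univ.erase u, G.pointerWeight a (f a) :=
    fun f => (Finset.mul_prod_erase _ _ (Finset.mem_univ u)).symm
  have h_off : ∏ a ∈ Finset.univ.erase u, G.pointerWeight a (Function.update f u c a) =
      ∏ a ∈ Finset.univ.erase u, G.pointerWeight a (f a) :=
    Finset.prod_congr rfl fun a ha => by rw [Function.update_of_ne (Finset.ne_of_mem_erase ha)]
  rw [h f, h (Function.update f u c), h_off, Function.update_self]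
  ring

theorem density_mul_pointerWeight (f : PointerMap (Fin n)) (u : Fin n) (c : Option (Fin n)) :
    G.density f * G.pointerWeight u c =
      G.density (Function.update f u c) * G.pointerWeight u (f u) := by
  unfold density
  rw [div_mul_eq_mul_div, mapWeight_mul_pointerWeight, div_mul_eq_mul_div]

theorem forestWeight_pointerArcs (f : PointerMap (Fin n)) :
    G.forestWeight (pointerArcs f) = G.mapWeight f := by
  unfold forestWeight mapWeight pointerArcs
  rw [Finset.prod_filter, ← Finset.univ_product_univ, Finset.prod_product]
  refine Finset.prod_congr rfl fun a _ => ?_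
  cases h : f a with
  | none => simp [pointerWeight, h]
  | some b => simp [pointerWeight, h]

theorem mapWeight_eq_zero {f : PointerMap (Fin n)} (h : ¬ pointerArcs f ⊆ G.arcs) :
    G.mapWeight f = 0 := by
  obtain ⟨⟨a, b⟩, he, hn⟩ := Finset.not_subset.1 h
  have hab : f a = some b := mem_pointerArcs.1 he
  refine Finset.prod_eq_zero (Finset.mem_univ a) ?_
  rw [hab]
  exact G.w_eq_zero a b hn

open scoped Classical in
theorem forestMass_pointerArcs (f : PointerMap (Fin n)) :
    G.forestMass (pointerArcs f) = if Acyclic f then ENNReal.ofReal (G.mapWeight f) else 0 := by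
  unfold forestMass
  simp only [pointerArcs_mem_inForests, forestWeight_pointerArcs]
  by_cases h : pointerArcs f ⊆ G.arcs
  · simp [h]
  · simp [h, G.mapWeight_eq_zero h]

variable {G} in
theorem exists_pointerArcs_of_forestMass_ne_zero {F : Finset (Fin n × Fin n)}
    (h : G.forestMass F ≠ 0) : ∃ f, pointerArcs f = F := by
  classical
  have hF : F ∈ G.inForests := by
    by_contra hF
    exact h (if_neg hF)
  simp only [inForests, Finset.mem_filter] at hF
  exact hF.2.exists_pointerArcs_eq

theorem tsum_forestMass : ∑' F, G.forestMass F = ENNReal.ofReal G.partitionFunction := by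
  rw [tsum_fintype, sum_eq_sum_pointerArcs _ fun F => exists_pointerArcs_of_forestMass_ne_zero,
    partitionFunction, ENNReal.ofReal_sum_of_nonneg fun f _ => G.mapWeight_nonneg f,
    Finset.sum_filter]
  exact Finset.sum_congr rfl fun f _ => G.forestMass_pointerArcs f

theorem forestPMF_apply (F : Finset (Fin n × Fin n)) :
    G.forestPMF F = G.forestMass F * (ENNReal.ofReal G.partitionFunction)⁻¹ := by
  rw [forestPMF, PMF.normalize_apply, tsum_forestMass]

variable {G} in
theorem exists_pointerArcs_of_forestPMF_ne_zero {F : Finset (Fin n × Fin n)}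
    (h : G.forestPMF F ≠ 0) : ∃ f, pointerArcs f = F := by
  rw [forestPMF_apply] at h
  exact exists_pointerArcs_of_forestMass_ne_zero (left_ne_zero_of_mul h)

open scoped Classical in
theorem forestPMF_pointerArcs (f : PointerMap (Fin n)) :
    G.forestPMF (pointerArcs f) = if Acyclic f then ENNReal.ofReal (G.density f) else 0 := by
  rw [forestPMF_apply, forestMass_pointerArcs, ite_mul, zero_mul, density,
    ENNReal.ofReal_div_of_pos G.partitionFunction_pos, ENNReal.div_eq_inv_mul, mul_comm]

open scoped Classical in
theorem sum_density_acyclic : ∑ f with Acyclic f, G.density f = 1 := by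
  simp only [density]
  rw [← Finset.sum_div]
  exact div_self G.partitionFunction_pos.ne'

open scoped Classical in
theorem forestPMF_mul_indicator_pointerArcs (f : PointerMap (Fin n)) (i j : Fin n) :
    (if pointerArcs f ∈ G.inForestsRootedAt i j then G.forestPMF (pointerArcs f) else 0) =
      ENNReal.ofReal (if Acyclic f ∧ RootOf f i j then G.density f else 0) := by
  rw [forestPMF_pointerArcs]
  simp only [pointerArcs_mem_inForestsRootedAt]
  by_cases h : pointerArcs f ⊆ G.arcs
  · by_cases h1 : Acyclic f <;> by_cases h2 : RootOf f i j <;> simp [h, h1, h2]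
  · simp [h, density, G.mapWeight_eq_zero h]

open scoped Classical in
theorem forestProb_eq_sum (i j : Fin n) :
    G.forestProb (G.inForestsRootedAt i j) =
      ∑ f with Acyclic f ∧ RootOf f i j, G.density f := by
  have hpos : ∀ f, 0 ≤ if Acyclic f ∧ RootOf f i j then G.density f else 0 := fun f => by
    split_ifs <;> simp [density_nonneg]
  rw [forestProb, PMF.toOuterMeasure_apply_finset, ← Finset.sum_ite_mem_eq,
    sum_eq_sum_pointerArcs, Finset.sum_filter]
  · simp only [forestPMF_mul_indicator_pointerArcs]
    rw [← ENNReal.ofReal_sum_of_nonneg fun f _ => hpos f,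
      ENNReal.toReal_ofReal (Finset.sum_nonneg fun f _ => hpos f)]
  · intro F hF
    refine exists_pointerArcs_of_forestPMF_ne_zero (G := G) fun h0 => hF ?_
    simp [h0]

theorem forestProb_nonneg (S : Finset (Finset (Fin n × Fin n))) : 0 ≤ G.forestProb S :=
  ENNReal.toReal_nonneg

theorem sum_forestProb (i : Fin n) : ∑ j, G.forestProb (G.inForestsRootedAt i j) = 1 := by
  classical
  have hsplit : ∀ j, G.forestProb (G.inForestsRootedAt i j) =
      ∑ f with Acyclic f, if RootOf f i j then G.density f else 0 := fun j => by
    rw [forestProb_eq_sum, ← Finset.filter_filter, Finset.sum_filter]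
  simp only [hsplit]
  rw [Finset.sum_comm, ← G.sum_density_acyclic]
  refine Finset.sum_congr rfl fun f hf => ?_
  obtain ⟨r, hr⟩ := (Finset.mem_filter.1 hf).2 i
  rw [Finset.sum_eq_single r]
  · exact if_pos hr
  · intro j _ hj
    exact if_neg fun h => hj (h.unique hr)
  · simp

/-! ### The matrix forest theorem -/

open scoped Classical in
theorem one_add_deg_mul_forestProb_eq_sum (i j : Fin n) :
    (1 + G.deg i) * G.forestProb (G.inForestsRootedAt i j) =
      ∑ p : PointerMap (Fin n) × Option (Fin n) with Acyclic p.1 ∧ RootOf p.1 i j,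
        G.density p.1 * G.pointerWeight i p.2 := by
  rw [forestProb_eq_sum, Finset.sum_filter, Finset.sum_filter, Fintype.sum_prod_type,
    Finset.mul_sum]
  refine Finset.sum_congr rfl fun f _ => ?_
  dsimp only
  split_ifs
  · rw [← Finset.mul_sum, sum_pointerWeight, mul_comm]
  · simp

open scoped Classical in
theorem sum_w_mul_forestProb_eq_sum (i j : Fin n) :
    (if i = j then 1 else 0) + ∑ k, G.w i k * G.forestProb (G.inForestsRootedAt k j) =
      ∑ p : PointerMap (Fin n) × Option (Fin n) with Acyclic p.1 ∧ RootVia p.1 i j p.2,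
        G.density p.1 * G.pointerWeight i p.2 := by
  rw [Finset.sum_filter, Fintype.sum_prod_type_right, Fintype.sum_option]
  congr 1
  · rw [← G.sum_density_acyclic, Finset.sum_filter]
    by_cases h : i = j <;> simp [RootVia, h, pointerWeight]
  · refine Finset.sum_congr rfl fun k _ => ?_
    rw [forestProb_eq_sum, Finset.sum_filter, Finset.mul_sum]
    refine Finset.sum_congr rfl fun f _ => ?_
    by_cases h : Acyclic f ∧ RootOf f k j <;> simp [RootVia, pointerWeight, h, mul_comm]

theorem density_mul_pointerWeight_exchange (i : Fin n)
    (p : PointerMap (Fin n) × Option (Fin n)) :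
    G.density (exchange i p).1 * G.pointerWeight i (exchange i p).2 =
      G.density p.1 * G.pointerWeight i p.2 := by
  unfold exchange
  split_ifs
  · exact (G.density_mul_pointerWeight p.1 i p.2).symm
  · rfl

theorem one_add_deg_mul_forestProb (i j : Fin n) :
    (1 + G.deg i) * G.forestProb (G.inForestsRootedAt i j) =
      (if i = j then 1 else 0) + ∑ k, G.w i k * G.forestProb (G.inForestsRootedAt k j) := by
  classical
  rw [one_add_deg_mul_forestProb_eq_sum, sum_w_mul_forestProb_eq_sum]
  refine Finset.sum_nbij' (exchange i) (exchange i) ?_ ?_ ?_ ?_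
    fun p _ => (G.density_mul_pointerWeight_exchange i p).symm
  all_goals simp only [Finset.mem_filter, Finset.mem_univ, true_and]
  · exact fun p ⟨hp, hr⟩ => ⟨acyclic_exchange hp i, (rootVia_exchange_iff hp).2 hr⟩
  · exact fun p ⟨hp, hr⟩ => ⟨acyclic_exchange hp i, (rootOf_exchange_iff hp).2 hr⟩
  · exact fun p ⟨hp, _⟩ => exchange_exchange hp i
  · exact fun p ⟨hp, _⟩ => exchange_exchange hp i

/-- The matrix of the probabilities `ℙ(φ ∈ Γ_ij)`. -/
noncomputable def forestMatrix : Matrix (Fin n) (Fin n) ℝ :=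
  Matrix.of fun i j => G.forestProb (G.inForestsRootedAt i j)

theorem one_add_laplacian_mul_forestMatrix : (1 + G.laplacian) * G.forestMatrix = 1 := by
  ext i j
  have h := G.one_add_deg_mul_forestProb i j
  simp only [laplacian, add_mul, sub_mul, one_mul, Matrix.add_apply, Matrix.sub_apply,
    Matrix.diagonal_mul, Matrix.one_apply]
  simp only [Matrix.mul_apply, forestMatrix, Matrix.of_apply]
  linarith

theorem forestMatrix_mul_one_add_laplacian : G.forestMatrix * (1 + G.laplacian) = 1 :=
  mul_eq_one_comm.1 G.one_add_laplacian_mul_forestMatrix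

theorem isUnit_one_add_laplacian : IsUnit (1 + G.laplacian) :=
  IsUnit.of_mul_eq_one _ G.one_add_laplacian_mul_forestMatrix

theorem equilibrium_eq (x : Fin n → ℝ) (i : Fin n) :
    G.equilibrium x i = ∑ j, G.forestProb (G.inForestsRootedAt i j) * x j := by
  rw [equilibrium, Matrix.inv_eq_right_inv G.one_add_laplacian_mul_forestMatrix]
  rfl

/-- By the matrix forest theorem the left side is `1 + ∑ k, ℙ(φ ∈ Γ_uk) w_ku`. -/
theorem one_add_deg_mul_forestProb_self_le {W : ℝ} (hW : ∀ i j, G.w i j ≤ W) (u : Fin n) :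
    (1 + G.deg u) * G.forestProb (G.inForestsRootedAt u u) ≤ 1 + W := by
  have h := congrFun (congrFun G.forestMatrix_mul_one_add_laplacian u) u
  simp only [laplacian, mul_add, mul_sub, mul_one, Matrix.add_apply, Matrix.sub_apply,
    Matrix.mul_diagonal, Matrix.one_apply, if_true] at h
  simp only [Matrix.mul_apply, forestMatrix, Matrix.of_apply] at h
  have h2 : ∑ k, G.forestProb (G.inForestsRootedAt u k) * G.w k u ≤ W := by
    refine (Finset.sum_le_sum fun k _ =>
      mul_le_mul_of_nonneg_left (hW k u) (G.forestProb_nonneg _)).trans_eq ?_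
    rw [← Finset.sum_mul, sum_forestProb, one_mul]
  linarith

/-! ### Convergence of the Friedkin–Johnsen dynamics -/

theorem sum_outNbrs (i : Fin n) (y : Fin n → ℝ) :
    ∑ j ∈ G.outNbrs i, G.w i j * y j = ∑ j, G.w i j * y j := by
  refine Finset.sum_subset (Finset.subset_univ _) fun j _ hj => ?_
  rw [G.w_eq_zero i j fun h => hj (Finset.mem_filter.2 ⟨Finset.mem_univ _, h⟩), zero_mul]

theorem fjUpdate_apply (x y : Fin n → ℝ) (i : Fin n) :
    G.fjUpdate x y i = (x i + ∑ j, G.w i j * y j) / (1 + G.deg i) := by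
  have h := G.sum_outNbrs i fun _ => 1
  simp only [mul_one] at h
  rw [fjUpdate, sum_outNbrs, h, deg]

theorem fjUpdate_equilibrium (x : Fin n → ℝ) :
    G.fjUpdate x (G.equilibrium x) = G.equilibrium x := by
  funext i
  rw [fjUpdate_apply, div_eq_iff (G.one_add_deg_pos i).ne']
  have h : (1 + G.laplacian).mulVec (G.equilibrium x) = x := by
    rw [equilibrium, Matrix.mulVec_mulVec, Matrix.mul_nonsing_inv _
      ((Matrix.isUnit_iff_isUnit_det _).1 G.isUnit_one_add_laplacian), Matrix.one_mulVec]
  have hi := congrFun h i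
  rw [laplacian, Matrix.add_mulVec, Matrix.sub_mulVec, Matrix.one_mulVec, Pi.add_apply,
    Pi.sub_apply, Matrix.mulVec_diagonal] at hi
  simp only [Matrix.mulVec, dotProduct, Matrix.of_apply] at hi
  linarith

theorem abs_sum_w_mul_sub_le (y z : Fin n → ℝ) (i : Fin n) :
    |∑ j, G.w i j * (y j - z j)| ≤ G.deg i * dist y z := by
  refine (Finset.abs_sum_le_sum_abs _ _).trans ?_
  rw [deg, Finset.sum_mul]
  refine Finset.sum_le_sum fun j _ => ?_
  rw [abs_mul, abs_of_nonneg (G.w_nonneg i j)]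
  exact mul_le_mul_of_nonneg_left (dist_le_pi_dist y z j) (G.w_nonneg i j)

/-- The contraction factor at `i` is `d_i / (1 + d_i)`; bounding `d_i` by the sum of all degrees
makes it uniform. -/
theorem exists_contractingWith_fjUpdate (x : Fin n → ℝ) :
    ∃ K, ContractingWith K (G.fjUpdate x) := by
  set D : ℝ := ∑ i, G.deg i
  have hD0 : 0 ≤ D := Finset.sum_nonneg fun i _ => G.deg_nonneg i
  have hK0 : 0 ≤ D / (1 + D) := by positivity
  refine ⟨Real.toNNReal (D / (1 + D)), ?_, LipschitzWith.of_dist_le_mul fun y z => ?_⟩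
  · rw [Real.toNNReal_lt_one, div_lt_one (by linarith)]
    linarith
  rw [Real.coe_toNNReal _ hK0]
  refine (dist_pi_le_iff (by positivity)).2 fun i => ?_
  have hp := G.one_add_deg_pos i
  have hi : G.deg i / (1 + G.deg i) ≤ D / (1 + D) := by
    rw [div_le_div_iff₀ hp (by linarith)]
    linarith [G.deg_le_sum_deg i]
  calc dist (G.fjUpdate x y i) (G.fjUpdate x z i)
      = |∑ j, G.w i j * (y j - z j)| / (1 + G.deg i) := by
        rw [fjUpdate_apply, fjUpdate_apply, Real.dist_eq, ← sub_div, abs_div, abs_of_pos hp,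
          add_sub_add_left_eq_sub, ← Finset.sum_sub_distrib]
        simp only [mul_sub]
    _ ≤ G.deg i * dist y z / (1 + G.deg i) := by gcongr; exact G.abs_sum_w_mul_sub_le y z i
    _ = G.deg i / (1 + G.deg i) * dist y z := by ring
    _ ≤ D / (1 + D) * dist y z := by gcongr

theorem tendsto_fjUpdate (x y : Fin n → ℝ) :
    Tendsto (fun k => (G.fjUpdate x)^[k] y) atTop (𝓝 (G.equilibrium x)) := by
  obtain ⟨K, hK⟩ := G.exists_contractingWith_fjUpdate x
  rw [hK.fixedPoint_unique (G.fjUpdate_equilibrium x)]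
  exact hK.tendsto_iterate_fixedPoint y

end WeightedDigraph

namespace PointerMap

theorem PathAvoiding.update_setOf_ne {α : Type*} [DecidableEq α] {f f' : PointerMap α} {u a : α}
    (h : PathAvoiding {x | f x ≠ f' x} f u a) (c : Option α) :
    PathAvoiding {x | Function.update f u c x ≠ Function.update f' u c x}
      (Function.update f u c) u a := by
  refine (h.mono fun x hx => ?_).congr fun x hx _ => Function.update_of_ne hx _ _
  by_cases hxu : x = u
  · simp [hxu] at hx
  · simpa [hxu] using hx

end PointerMap

namespace WeightedDigraph

open PointerMap RandProg

variable {n : ℕ} {S : Set (Fin n)} {s t : SampleState n} {i u : Fin n}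

/-! ### The two inner loops -/

/-- The test of both inner loops: the current node is not in the forest. -/
def unvisited (p : Fin n × SampleState n) : Bool := !p.2.inforest p.1

/-- The state after `u` has joined the forest as a root. -/
@[simps]
def absorb (u : Fin n) (s : SampleState n) : SampleState n where
  inforest := Function.update s.inforest u true
  next := Function.update s.next u none
  root := Function.update s.root u (some u)

/-- The state after `v` has been recorded as the next node of `u`. -/
@[simps]
def record (u v : Fin n) (s : SampleState n) : SampleState n :=
  { s with next := Function.update s.next u (some v) }

/-- The state after `u` has joined the forest with root `r`. -/
@[simps]
def attach (r : Option (Fin n)) (u : Fin n) (s : SampleState n) : SampleState n :=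
  { s with
    inforest := Function.update s.inforest u true
    root := Function.update s.root u r }

theorem unvisited_eq_false {p : Fin n × SampleState n} :
    unvisited p = false ↔ p.2.inforest p.1 = true := by
  simp [unvisited]

theorem unvisited_eq_true {p : Fin n × SampleState n} :
    unvisited p = true ↔ p.2.inforest p.1 = false := by
  simp [unvisited]

theorem unvisited_absorb (u : Fin n) (s : SampleState n) : unvisited (u, absorb u s) = false := by
  simp [unvisited, absorb]

theorem retraceBody_eq (r : Option (Fin n)) (u : Fin n) (s : SampleState n) :
    retraceBody r (u, s) = tick 3 >>= fun _ => pure ((s.next u).getD u, attach r u s) := rfl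

theorem wp_retraceBody (r : Option (Fin n)) (u : Fin n) (s : SampleState n)
    (g : Fin n × SampleState n → ℕ → ℝ≥0∞) :
    (retraceBody r (u, s)).wp g = g ((s.next u).getD u, attach r u s) 3 := by
  rw [retraceBody_eq, wp_bind, wp_tick, wp_pure]

theorem haltProb_retraceBody (r : Option (Fin n)) (p : Fin n × SampleState n) :
    (retraceBody r p).haltProb = 1 :=
  wp_retraceBody r p.1 p.2 fun _ _ => 1

variable (G : WeightedDigraph n)

theorem walkBody_eq (u : Fin n) (s : SampleState n) :
    G.walkBody (u, s) = randLE (1 / (1 + G.deg u)) >>= fun absorbed =>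
      if absorbed then tick 3 >>= fun _ => pure (u, absorb u s)
      else G.randomSuccessor u >>= fun v => tick 2 >>= fun _ => pure (v, record u v s) := rfl

theorem visitNode_eq (s : SampleState n) (i : Fin n) :
    G.visitNode s i = tick 2 >>= fun _ => whileLoop unvisited G.walkBody (i, s) >>= fun p =>
      tick 2 >>= fun _ => whileLoop unvisited (retraceBody (p.2.root p.1)) (i, p.2) >>= fun q =>
        pure q.2 := rfl

theorem sampleForest_eq : G.sampleForest = tick (3 * n) >>= fun _ =>
    List.foldlM G.visitNode (SampleState.init n) (List.finRange n) := rfl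

/-- The transition probabilities of the walk; the choice `none` ends it. -/
noncomputable def stepProb (u : Fin n) (c : Option (Fin n)) : ℝ≥0∞ :=
  ENNReal.ofReal (G.pointerWeight u c / (1 + G.deg u))

theorem sum_stepProb (u : Fin n) : ∑ c, G.stepProb u c = 1 := by
  unfold stepProb
  rw [← ENNReal.ofReal_sum_of_nonneg fun c _ =>
    div_nonneg (G.pointerWeight_nonneg u c) (G.one_add_deg_pos u).le, ← Finset.sum_div,
    sum_pointerWeight, div_self (G.one_add_deg_pos u).ne', ENNReal.ofReal_one]

theorem stepProb_none_add (u : Fin n) :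
    G.stepProb u none + ∑ v, G.stepProb u (some v) = 1 := by
  rw [← G.sum_stepProb u, Fintype.sum_option]

theorem le_stepProb_none (u : Fin n) :
    ENNReal.ofReal (1 / (1 + ∑ v, G.deg v)) ≤ G.stepProb u none :=
  ENNReal.ofReal_le_ofReal (one_div_le_one_div_of_le (G.one_add_deg_pos u)
    (add_le_add_right (G.deg_le_sum_deg u) 1))

theorem ofReal_mul_ofReal_eq_stepProb (u v : Fin n) :
    ENNReal.ofReal (1 - 1 / (1 + G.deg u)) * ENNReal.ofReal (G.w u v / G.deg u) =
      G.stepProb u (some v) := by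
  have hp := G.one_add_deg_pos u
  have hd := G.deg_nonneg u
  rw [← ENNReal.ofReal_mul (by rw [sub_nonneg, div_le_one hp]; linarith)]
  change _ = ENNReal.ofReal (G.w u v / _)
  congr 1
  rcases hd.eq_or_lt with h0 | h0
  · have hv : G.w u v = 0 := le_antisymm
      ((Finset.single_le_sum (fun v _ => G.w_nonneg u v) (Finset.mem_univ v)).trans_eq h0.symm)
      (G.w_nonneg u v)
    simp [hv]
  · field_simp
    ring

theorem wp_randomSuccessor (u : Fin n) (g : Fin n → ℕ → ℝ≥0∞) :
    (G.randomSuccessor u).wp g =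
      ∑ v, ENNReal.ofReal (G.w u v / G.deg u) * g v (outCount G.arcs u) :=
  (wp_of_const_cost (fun v => ENNReal.ofReal (G.w u v / G.deg u)) _ g).trans (tsum_fintype _)

theorem wp_walkBody (u : Fin n) (s : SampleState n) (g : Fin n × SampleState n → ℕ → ℝ≥0∞) :
    (G.walkBody (u, s)).wp g = G.stepProb u none * g (u, absorb u s) 5 +
      ∑ v, G.stepProb u (some v) * g (v, record u v s) (outCount G.arcs u + 4) := by
  have hp := G.one_add_deg_pos u
  have hd := G.deg_nonneg u
  rw [walkBody_eq, wp_bind, wp_randLE (by positivity) ((div_le_one hp).2 (by linarith))]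
  simp only [if_true, Bool.false_eq_true, if_false, wp_bind, wp_tick, wp_pure,
    wp_randomSuccessor, Finset.mul_sum]
  congr 1
  refine Finset.sum_congr rfl fun v _ => ?_
  rw [← mul_assoc, ofReal_mul_ofReal_eq_stepProb]
  congr 2
  omega

theorem expect_walkBody (u : Fin n) (s : SampleState n) (g : Fin n × SampleState n → ℝ≥0∞) :
    (G.walkBody (u, s)).expect g = G.stepProb u none * g (u, absorb u s) +
      ∑ v, G.stepProb u (some v) * g (v, record u v s) :=
  G.wp_walkBody u s _

theorem haltProb_walkBody (p : Fin n × SampleState n) : (G.walkBody p).haltProb = 1 := by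
  obtain ⟨u, s⟩ := p
  rw [haltProb, expect_walkBody]
  simp only [mul_one]
  exact G.stepProb_none_add u

theorem expectedCost_walkBody_le (u : Fin n) (s : SampleState n) :
    (G.walkBody (u, s)).expectedCost ≤ (outCount G.arcs u + 5 : ℕ) := by
  rw [expectedCost_eq_wp, wp_walkBody, ← mul_one ((outCount G.arcs u + 5 : ℕ) : ℝ≥0∞),
    ← G.stepProb_none_add u, mul_add, Finset.mul_sum]
  refine add_le_add ?_ (Finset.sum_le_sum fun v _ => ?_)
  all_goals
    rw [mul_comm]
    gcongr
    omega

theorem haltProb_walk (p : Fin n × SampleState n) :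
    (whileLoop unvisited G.walkBody p).haltProb = 1 := by
  have hD : 0 < 1 + ∑ v, G.deg v := by
    linarith [Finset.sum_nonneg fun v (_ : v ∈ Finset.univ) => G.deg_nonneg v]
  refine haltProb_whileLoop_eq_one G.haltProb_walkBody
    (ENNReal.ofReal_pos.2 (one_div_pos.2 hD)).ne' (fun ⟨u, s⟩ _ => ?_) p
  rw [expect_walkBody, unvisited_absorb]
  refine (G.le_stepProb_none u).trans (le_add_right ?_)
  simp

theorem haltProb_visitNode_le_one (s : SampleState n) (i : Fin n) :
    (G.visitNode s i).haltProb ≤ 1 := by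
  rw [visitNode_eq]
  refine haltProb_bind_le_one (haltProb_tick 2).le fun _ =>
    haltProb_bind_le_one (G.haltProb_walk _).le fun p =>
    haltProb_bind_le_one (haltProb_tick 2).le fun _ => haltProb_bind_le_one
      (haltProb_whileLoop_le_one (fun q => (haltProb_retraceBody _ q).le) _) fun q =>
      (haltProb_pure q.2).le

/-! ### Stale records do not matter -/

/-- Two states agree on their common forest, which contains `S`. Their records at the nodes outside
the forest may differ: these are overwritten before they are read. -/
structure SameForest (S : Set (Fin n)) (s t : SampleState n) : Prop where
  inforest_eq : s.inforest = t.inforest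
  next_eq : ∀ a, s.inforest a = true → s.next a = t.next a
  root_eq : ∀ a, s.inforest a = true → s.root a = t.root a
  mem : ∀ a ∈ S, s.inforest a = true

theorem SameForest.eq (h : SameForest Set.univ s t) : s = t := by
  obtain ⟨inforest, next, root⟩ := s
  obtain ⟨inforest', next', root'⟩ := t
  obtain ⟨h1, h2, h3, h4⟩ := h
  dsimp only at h1 h2 h3 h4
  simp only [SampleState.mk.injEq]
  exact ⟨h1, funext fun a => h2 a (h4 a trivial), funext fun a => h3 a (h4 a trivial)⟩

theorem SameForest.unvisited_eq (h : SameForest S s t) (u : Fin n) :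
    unvisited (u, s) = unvisited (u, t) :=
  congrArg (fun A : Fin n → Bool => !A u) h.inforest_eq

theorem SameForest.absorb (h : SameForest S s t) (u : Fin n) :
    SameForest S (absorb u s) (absorb u t) := by
  obtain ⟨h1, h2, h3, h4⟩ := h
  constructor <;> grind [absorb_inforest, absorb_next, absorb_root]

theorem SameForest.record (h : SameForest S s t) (hu : s.inforest u = false) (v : Fin n) :
    SameForest S (record u v s) (record u v t) where
  inforest_eq := h.inforest_eq
  next_eq a ha := by
    have hau : a ≠ u := ne_of_apply_ne s.inforest (by simpa [hu] using ha)
    simpa [Function.update_of_ne hau] using h.next_eq a ha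
  root_eq := h.root_eq
  mem := h.mem

theorem SameForest.attach (h : SameForest S s t) (hu : s.next u = t.next u)
    (r : Option (Fin n)) : SameForest S (attach r u s) (attach r u t) := by
  obtain ⟨h1, h2, h3, h4⟩ := h
  constructor <;> grind [attach_inforest, attach_next, attach_root]

/-- The invariant of two coupled walks from `i`: the records on the loop-erased walk agree. -/
def WalkCoupled (S : Set (Fin n)) (i : Fin n) (p q : Fin n × SampleState n) : Prop :=
  p.1 = q.1 ∧ SameForest S p.2 q.2 ∧
    PathAvoiding {x | p.2.next x ≠ q.2.next x} p.2.next p.1 i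

theorem coupled_walk (h : SameForest S s t) :
    Coupled (fun p q => WalkCoupled S i p q ∧ unvisited p = false)
      (whileLoop unvisited G.walkBody (i, s)) (whileLoop unvisited G.walkBody (i, t)) := by
  refine Coupled.whileLoop (R := WalkCoupled S i) ?_ ?_ ⟨rfl, h, .refl⟩
  · rintro ⟨u, s⟩ ⟨_, t⟩ ⟨rfl, h, _⟩
    exact h.unvisited_eq u
  · rintro ⟨u, s⟩ ⟨_, t⟩ ⟨rfl, h, hp⟩ hc
    rw [walkBody_eq, walkBody_eq]
    refine Coupled.bind_left _ fun absorbed => ?_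
    split_ifs
    · exact Coupled.bind_left _ fun _ =>
        Coupled.pure ⟨rfl, h.absorb u, hp.update_setOf_ne none⟩
    · exact Coupled.bind_left _ fun v => Coupled.bind_left _ fun _ => Coupled.pure
        ⟨rfl, h.record (unvisited_eq_true.1 hc) v,
          (hp.update_setOf_ne (some v)).extend (by simp) (by simp)⟩

/-- The invariant of two coupled retraces from `i`: the records still to be followed agree. -/
def RetraceCoupled (S : Set (Fin n)) (i : Fin n) (p q : Fin n × SampleState n) : Prop :=
  p.1 = q.1 ∧ SameForest S p.2 q.2 ∧ (p.2.inforest i = true ∨ p.1 = i) ∧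
    ∃ u, p.2.inforest u = true ∧ PathAvoiding {x | p.2.next x ≠ q.2.next x} p.2.next u p.1

theorem coupled_retrace (h : SameForest S s t) (hu : s.inforest u = true)
    (hp : PathAvoiding {x | s.next x ≠ t.next x} s.next u i) (r : Option (Fin n)) :
    Coupled (fun p q => RetraceCoupled S i p q ∧ unvisited p = false)
      (whileLoop unvisited (retraceBody r) (i, s))
      (whileLoop unvisited (retraceBody r) (i, t)) := by
  refine Coupled.whileLoop (R := RetraceCoupled S i) ?_ ?_ ⟨rfl, h, .inr rfl, u, hu, hp⟩
  · rintro ⟨a, s⟩ ⟨_, t⟩ ⟨rfl, h, _⟩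
    exact h.unvisited_eq a
  · rintro ⟨a, s⟩ ⟨_, t⟩ ⟨rfl, h, hi, u, hu, hp⟩ hc
    rw [retraceBody_eq, retraceBody_eq]
    refine Coupled.bind_left _ fun _ => Coupled.pure ?_
    dsimp only at hp hi hu h
    have inforest_attach : ∀ x, s.inforest x = true ∨ a = x →
        (attach r a s).inforest x = true := by
      grind [attach_inforest]
    cases hp with
    | refl => simp [unvisited, hu] at hc
    | @step _ b _ hab hb hpb =>
      have hab : s.next a = t.next a := by simpa using hab
      rw [← hab, hb]
      exact ⟨rfl, h.attach hab r, .inl (inforest_attach i hi), u, inforest_attach u (.inl hu), hpb⟩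

theorem coupled_visitNode (h : SameForest S s t) (i : Fin n) :
    Coupled (SameForest (insert i S)) (G.visitNode s i) (G.visitNode t i) := by
  rw [visitNode_eq, visitNode_eq]
  refine Coupled.bind_left _ fun _ => (G.coupled_walk h).bind ?_
  rintro ⟨u, s⟩ ⟨_, t⟩ ⟨⟨rfl, h, hp⟩, hc⟩
  have hu := unvisited_eq_false.1 hc
  refine Coupled.bind_left _ fun _ => ?_
  dsimp only at h hp hu ⊢
  rw [← h.root_eq u hu]
  refine (coupled_retrace h hu hp _).bind ?_
  rintro ⟨a, s⟩ ⟨_, t⟩ ⟨⟨rfl, h, hi, _⟩, hc⟩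
  have hi : s.inforest i = true := hi.elim id fun hai => hai ▸ unvisited_eq_false.1 hc
  exact Coupled.pure ⟨h.inforest_eq, h.next_eq, h.root_eq, Set.forall_mem_insert.2 ⟨hi, h.mem⟩⟩

theorem coupled_foldlM_visitNode (l : List (Fin n)) (h : SameForest S s t) :
    Coupled (SameForest (S ∪ {i | i ∈ l})) (List.foldlM G.visitNode s l)
      (List.foldlM G.visitNode t l) := by
  induction l generalizing S s t with
  | nil => exact Coupled.pure (by simpa using h)
  | cons i l ih =>
    rw [List.foldlM_cons, List.foldlM_cons]
    refine (G.coupled_visitNode h i).bind fun s t hst => (ih hst).mono fun a b hab => ?_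
    have hset : S ∪ {j | j ∈ i :: l} = insert i S ∪ {j | j ∈ l} := by
      ext x
      simp only [Set.mem_union, Set.mem_ofPred_eq, List.mem_cons, Set.mem_insert_iff]
      tauto
    rwa [hset]

theorem wp_foldlM_visitNode_congr (h : SameForest ∅ s t) (g : SampleState n → ℕ → ℝ≥0∞) :
    wp (List.foldlM G.visitNode s (List.finRange n)) g =
      wp (List.foldlM G.visitNode t (List.finRange n)) g := by
  have huniv : (∅ : Set (Fin n)) ∪ {i | i ∈ List.finRange n} = Set.univ := by
    ext x
    simp
  refine G.coupled_foldlM_visitNode (List.finRange n) h g g fun a b hab k => ?_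
  rw [huniv] at hab
  rw [hab.eq]

end WeightedDigraph

namespace PointerMap

/-! ### Occupation of the walk -/

variable {α : Type*} {f : PointerMap α} {S : Set α} {i r u v : α}

theorem reached_insert_of_leads (h : Leads f i u) :
    Reached f (insert i (insert u S)) = Reached f (insert i S) := by
  ext x
  simp only [mem_reached_insert]
  refine ⟨?_, by tauto⟩
  rintro ((hx | hx) | hx)
  exacts [.inl hx, .inr (h.trans hx), .inr hx]

variable [DecidableEq α]

/-- The walk from `i`, started from random records when the nodes of `S` have been treated, may
be at `u` with records `f`. The records may contain a cycle, but only one through the current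
node. -/
structure Occupied (S : Set α) (i u : α) (f : PointerMap α) : Prop where
  acyclic_cut : Acyclic (Function.update f u none)
  path : PathAvoiding (Reached f S) f u i
  acyclic : u ∈ Reached f S → Acyclic f

theorem Occupied.update (h : Occupied S i u f) (hu : u ∉ Reached f S) (c : Option α) :
    Occupied S i u (Function.update f u c) where
  acyclic_cut := by
    rw [Function.update_idem]
    exact h.acyclic_cut
  path := by
    rw [reached_update hu]
    exact h.path.congr fun x hx _ => Function.update_of_ne hx _ _
  acyclic hu' := absurd hu' (by rwa [reached_update hu])

theorem occupied_update_iff (f : PointerMap α) (c : Option α) :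
    (Occupied S i u (Function.update f u c) ∧ u ∉ Reached (Function.update f u c) S) ↔
      Occupied S i u f ∧ u ∉ Reached f S := by
  have update : ∀ (f : PointerMap α) c, Occupied S i u f ∧ u ∉ Reached f S →
      Occupied S i u (Function.update f u c) ∧ u ∉ Reached (Function.update f u c) S :=
    fun f c h => ⟨h.1.update h.2 c, (reached_update h.2 c).symm ▸ h.2⟩
  refine ⟨fun h => ?_, update f c⟩
  simpa only [Function.update_idem, Function.update_eq_self] using update _ (f u) h

theorem Occupied.next (h : Occupied S i u f) (hu : u ∉ Reached f S) (hv : f u = some v) :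
    Occupied S i v f where
  acyclic_cut := h.acyclic_cut.cut_next hv
  path := h.path.extend hu hv
  acyclic hvS := h.acyclic_cut.of_update_none hu hvS hv

theorem occupied_self (S : Set α) (i : α) (hf : Acyclic f) : Occupied S i i f :=
  ⟨hf.update_none i, .refl, fun _ => hf⟩

theorem Occupied.acyclic_of_end (h : Occupied S i u f) (hu : u ∈ Reached f S ∨ f u = none) :
    Acyclic f := by
  rcases hu with hu | hu
  · exact h.acyclic hu
  · simpa only [← hu, Function.update_eq_self] using h.acyclic_cut

theorem existsUnique_occupied_end (hf : Acyclic f) (S : Set α) (i : α) :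
    ∃! u, Occupied S i u f ∧ (u ∈ Reached f S ∨ f u = none) := by
  obtain ⟨r, hr⟩ := hf i
  obtain ⟨u, hp, hu⟩ := hr.exists_pathAvoiding (Reached f S)
  exact ⟨u, ⟨⟨hf.update_none u, hp, fun _ => hf⟩, hu⟩, fun v hv =>
    hv.1.path.end_unique hp hv.2 hu⟩

open scoped Classical in
theorem sum_occupied_end [Fintype α] (S : Set α) (i : α) (f : PointerMap α) (c : ℝ≥0∞) :
    (∑ u, if Occupied S i u f ∧ (u ∈ Reached f S ∨ f u = none) then c else 0) =
      if Acyclic f then c else 0 := by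
  split_ifs with hf
  · obtain ⟨u, hu, hu'⟩ := existsUnique_occupied_end hf S i
    rw [Finset.sum_eq_single u (fun v _ hv => if_neg fun h => hv (hu' v h)) (by simp), if_pos hu]
  · exact Finset.sum_eq_zero fun u _ => if_neg fun h => hf (h.1.acyclic_of_end h.2)

omit [DecidableEq α] in
theorem sum_elim_le_sum_of_injOn (s t : Finset α) (h : α → ℝ≥0∞)
    (hinj : ∀ u ∈ s, ∀ u' ∈ s, ∀ v, f u = some v → f u' = some v → u = u')
    (hst : ∀ u ∈ s, ∀ v, f u = some v → v ∈ t) :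
    ∑ u ∈ s, (f u).elim 0 h ≤ ∑ v ∈ t, h v := by
  classical
  calc ∑ u ∈ s, (f u).elim 0 h ≤ ∑ u ∈ s, ∑ v ∈ t, if f u = some v then h v else 0 := by
        refine Finset.sum_le_sum fun u hu => ?_
        cases hv : f u with
        | none => simp
        | some v => simp [hst u hu v hv]
    _ = ∑ v ∈ t, ∑ u ∈ s, if f u = some v then h v else 0 := Finset.sum_comm
    _ ≤ ∑ v ∈ t, h v := by
        refine Finset.sum_le_sum fun v _ => ?_
        by_cases hv : ∃ u ∈ s, f u = some v
        · obtain ⟨u, hu, huv⟩ := hv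
          rw [Finset.sum_eq_single_of_mem u hu fun u' hu' hne => if_neg fun hu'v =>
            hne (hinj u' hu' u hu v hu'v huv), if_pos huv]
        · push Not at hv
          rw [Finset.sum_eq_zero fun u hu => if_neg (hv u hu)]
          exact zero_le

open scoped Classical in
/-- The walk arrives at each occupied node from at most one other, and at its start `i`, with
acyclic records, from none: these occupations are the starts of the walk. -/
theorem sum_next_le_sum_occupied [Fintype α] (S : Set α) (i : α) (f : PointerMap α)
    (h : α → ℝ≥0∞) :
    ((if Acyclic f then h i else 0) +
      ∑ u with Occupied S i u f ∧ u ∉ Reached f S, (f u).elim 0 h) ≤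
      ∑ v with Occupied S i v f, h v := by
  have hinj : ∀ u ∈ ({u | Occupied S i u f ∧ u ∉ Reached f S} : Finset α),
      ∀ u' ∈ ({u | Occupied S i u f ∧ u ∉ Reached f S} : Finset α),
      ∀ v, f u = some v → f u' = some v → u = u' := fun u hu u' hu' v huv hu'v => by
    have hu := (Finset.mem_filter.1 hu).2.1
    have hu' := (Finset.mem_filter.1 hu').2.1
    exact eq_of_next_eq hu.acyclic_cut hu'.acyclic_cut hu.path.leads hu'.path.leads huv hu'v
  split_ifs with hf
  · rw [← Finset.add_sum_erase _ h (Finset.mem_filter.2 ⟨Finset.mem_univ i, occupied_self S i hf⟩)]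
    refine add_le_add_right (sum_elim_le_sum_of_injOn _ _ h hinj fun u hu v hv => ?_) _
    have hu := (Finset.mem_filter.1 hu).2
    refine Finset.mem_erase.2 ⟨?_, Finset.mem_filter.2 ⟨Finset.mem_univ v, hu.1.next hu.2 hv⟩⟩
    rintro rfl
    exact hf.not_leads hv hu.1.path.leads
  · rw [zero_add]
    refine sum_elim_le_sum_of_injOn _ _ h hinj fun u hu v hv => ?_
    have hu := (Finset.mem_filter.1 hu).2
    exact Finset.mem_filter.2 ⟨Finset.mem_univ v, hu.1.next hu.2 hv⟩

end PointerMap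

namespace WeightedDigraph

open PointerMap RandProg

variable {n : ℕ} {f : PointerMap (Fin n)} {S T : Set (Fin n)} {s : SampleState n}
  {a b i r u : Fin n}

/-! ### Rounds started from random records -/

open scoped Classical in
/-- The state with records `f` in which the nodes of `S` have been treated. -/
noncomputable def forestState (S : Set (Fin n)) (f : PointerMap (Fin n)) : SampleState n where
  inforest a := decide (a ∈ Reached f S)
  next := f
  root a := if a ∈ Reached f S then rootOf f a else none

theorem inforest_forestState : (forestState S f).inforest a = true ↔ a ∈ Reached f S := by
  simp [forestState]

theorem forestState_congr (h : Reached f S = Reached f T) : forestState S f = forestState T f := by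
  classical
  simp only [forestState, h]

theorem record_forestState (hu : u ∉ Reached f S) (v : Fin n) :
    record u v (forestState S f) = forestState S (Function.update f u (some v)) := by
  classical
  simp only [record, forestState, SampleState.mk.injEq, reached_update hu, true_and]
  exact funext fun a => ite_congr rfl (fun ha => (rootOf_update hu ha _).symm) fun _ => rfl

theorem absorb_forestState (hu : u ∉ Reached f S) :
    absorb u (forestState S f) = forestState (insert u S) (Function.update f u none) := by
  classical
  have hl : ∀ a, Leads (Function.update f u none) u a ↔ u = a :=
    fun a => leads_iff_of_eq_none (by simp)
  have hr : rootOf (Function.update f u none) u = some u := rootOf_eq_some (.root (by simp))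
  simp only [absorb, forestState, SampleState.mk.injEq, mem_reached_insert, reached_update hu,
    true_and, hl]
  constructor <;> funext a <;> by_cases ha : a = u
  · simp [ha]
  · simp [ha, Ne.symm ha]
  · simp [ha, hr]
  · by_cases haS : a ∈ Reached f S
    · simp [ha, haS, rootOf_update hu haS]
    · simp [ha, Ne.symm ha, haS]

theorem sameForest_init (f : PointerMap (Fin n)) :
    SameForest ∅ (SampleState.init n) (forestState ∅ f) where
  inforest_eq := by
    funext a
    simp [forestState, SampleState.init, reached_empty]
  next_eq a ha := by simp [SampleState.init] at ha
  root_eq a ha := by simp [SampleState.init] at ha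
  mem a ha := absurd ha (Set.notMem_empty a)

theorem unvisited_forestState : unvisited (u, forestState S f) = true ↔ u ∉ Reached f S := by
  simp [unvisited, forestState]

open scoped Classical in
/-- The state after the nodes met from `a` have joined the forest with root `r`. -/
noncomputable def retraced (r : Option (Fin n)) (a : Fin n) (s : SampleState n) :
    SampleState n where
  inforest x := s.inforest x || decide (Leads s.next a x)
  next := s.next
  root x := if s.inforest x = false ∧ Leads s.next a x then r else s.root x

theorem retraced_of_mem {r : Option (Fin n)} (h : ∀ x, Leads s.next a x → s.inforest x = true) :
    retraced r a s = s := by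
  obtain ⟨inforest, next, root⟩ := s
  simp only [retraced, SampleState.mk.injEq, true_and]
  constructor <;> funext x <;> by_cases hx : Leads next a x
  · simpa [hx] using (h x hx).symm
  · simp [hx]
  · simpa [hx] using fun hx' => absurd (h x hx) (by simp [hx'])
  · simp [hx]

theorem retraced_attach {r : Option (Fin n)} (ha : s.inforest a = false)
    (hab : ∀ x, Leads s.next a x ↔ a = x ∨ Leads s.next b x) :
    retraced r b (attach r a s) = retraced r a s := by
  classical
  simp only [retraced, attach, SampleState.mk.injEq, true_and, hab]
  constructor <;> funext x <;> by_cases hx : x = a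
  · simp [hx]
  · by_cases hbx : Leads s.next b x <;> simp [hx, Ne.symm hx, hbx]
  · simp [hx, ha]
  · simp [hx, Ne.symm hx]

theorem expect_retrace {r : Option (Fin n)} (ha : RootOf s.next a u)
    (hs : ∀ x y, Leads s.next a x → Leads s.next x y → s.inforest x = true → s.inforest y = true)
    (g : SampleState n → ℝ≥0∞) :
    ((whileLoop unvisited (retraceBody r) (a, s)).expect fun p => g p.2) =
      g (retraced r a s) := by
  obtain ⟨inforest, f, root⟩ := s
  dsimp only at ha hs
  induction ha generalizing inforest root with
  | @root a hf =>
    have hl : ∀ x, Leads f a x ↔ a = x := fun x => leads_iff_of_eq_none hf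
    rw [expect_whileLoop]
    split_ifs with hc
    · rw [expect, wp_retraceBody]
      dsimp only
      rw [hf, Option.getD_none, expect_whileLoop, if_neg (by simp [unvisited]),
        ← retraced_attach (unvisited_eq_true.1 hc) (b := a) (by simp [hl]), retraced_of_mem]
      intro x hx
      obtain rfl := (hl x).1 hx
      simp
    · have hA : inforest a = true := by simpa [unvisited] using hc
      rw [retraced_of_mem fun x hx => (hl x).1 hx ▸ hA]
  | @step a b ρ hf hb ih =>
    rw [expect_whileLoop]
    split_ifs with hc
    · have hba : ¬ Leads f b a := (RootOf.step hf hb).not_leads hf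
      rw [expect, wp_retraceBody]
      dsimp only
      rw [hf, Option.getD_some, attach, ih, ← retraced_attach (unvisited_eq_true.1 hc)
        fun _ => leads_iff hf]
      · rfl
      · intro x y hx hy hxA
        have hxa : x ≠ a := by rintro rfl; exact hba hx
        have hya : y ≠ a := by rintro rfl; exact hba (hx.trans hy)
        rw [Function.update_of_ne hxa] at hxA
        rw [Function.update_of_ne hya]
        exact hs x y (.head hf hx) hy hxA
    · have hA : inforest a = true := by simpa [unvisited] using hc
      rw [retraced_of_mem fun x hx => hs a x .refl hx hA]

theorem retraced_forestState (hu : u ∈ Reached f S) (hl : Leads f i u) :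
    retraced ((forestState S f).root u) i (forestState S f) = forestState (insert i S) f := by
  classical
  simp only [retraced, forestState, SampleState.mk.injEq, true_and, mem_reached_insert, if_pos hu]
  constructor <;> funext x <;> by_cases hx : x ∈ Reached f S
  · simp [hx]
  · by_cases hix : Leads f i x <;> simp [hx, hix]
  · simp [hx]
  · by_cases hix : Leads f i x
    · simp [hx, hix, ← rootOf_eq_of_leads hl, rootOf_eq_of_leads hix]
    · simp [hx, hix]

theorem expect_retrace_forestState (hi : RootOf f i r) (hu : u ∈ Reached f S) (hl : Leads f i u)
    (g : SampleState n → ℝ≥0∞) :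
    ((whileLoop unvisited (retraceBody ((forestState S f).root u)) (i, forestState S f)).expect
      fun p => g p.2) = g (forestState (insert i S) f) := by
  rw [expect_retrace hi, retraced_forestState hu hl]
  intro x y _ hxy hx
  rw [inforest_forestState] at hx ⊢
  exact Leads.mem_reached hxy hx

theorem expect_retrace_absorb_forestState (hu : u ∉ Reached f S)
    (hl : Leads (Function.update f u none) i u) (g : SampleState n → ℝ≥0∞) :
    ((whileLoop unvisited (retraceBody ((absorb u (forestState S f)).root u))
      (i, absorb u (forestState S f))).expect fun p => g p.2) =
      g (forestState (insert i S) (Function.update f u none)) := by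
  rw [absorb_forestState hu, expect_retrace_forestState (r := u) (.of_leads hl (.root (by simp)))
    (subset_reached _ _ (Set.mem_insert u S)) hl, forestState_congr (reached_insert_of_leads hl)]

/-! ### The law of a round -/

variable (G : WeightedDigraph n)

/-- The probability of the in-forest given by a pointer map. -/
noncomputable def mapProb (f : PointerMap (Fin n)) : ℝ≥0∞ := G.forestPMF (pointerArcs f)

open scoped Classical in
theorem mapProb_eq (f : PointerMap (Fin n)) :
    G.mapProb f = if Acyclic f then ENNReal.ofReal (G.density f) else 0 :=
  G.forestPMF_pointerArcs f

theorem sum_mapProb : ∑ f, G.mapProb f = 1 := by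
  have h := G.forestPMF.tsum_coe
  rwa [tsum_fintype, sum_eq_sum_pointerArcs _ fun F => G.exists_pointerArcs_of_forestPMF_ne_zero]
    at h

theorem mapProb_ne_top (f : PointerMap (Fin n)) : G.mapProb f ≠ ∞ := PMF.apply_ne_top _ _

open scoped Classical in
/-- The expected number of times that the walk from `i`, started from random records when the nodes
of `S` have been treated, is at `u` outside the forest with records `f`. -/
noncomputable def walkMass (S : Set (Fin n)) (i u : Fin n) (f : PointerMap (Fin n)) : ℝ≥0∞ :=
  if Occupied S i u f ∧ u ∉ Reached f S then ENNReal.ofReal (G.density f) else 0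

open scoped Classical in
/-- The probability that the walk from `i`, started from random records when the nodes of `S` have
been treated, hits the forest at `u` with records `f`. -/
noncomputable def hitMass (S : Set (Fin n)) (i u : Fin n) (f : PointerMap (Fin n)) : ℝ≥0∞ :=
  if Occupied S i u f ∧ u ∈ Reached f S then ENNReal.ofReal (G.density f) else 0

theorem walkMass_ne_top (S : Set (Fin n)) (i u : Fin n) (f : PointerMap (Fin n)) :
    G.walkMass S i u f ≠ ∞ := by
  unfold walkMass
  split_ifs <;> simp

theorem sum_walkMass_resample (S : Set (Fin n)) (i u : Fin n) (H : PointerMap (Fin n) → ℝ≥0∞) :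
    ∑ f, G.walkMass S i u f * ∑ c, G.stepProb u c * H (Function.update f u c) =
      ∑ f, G.walkMass S i u f * H f := by
  have detailed_balance : ∀ f c, G.walkMass S i u f * G.stepProb u c =
      G.walkMass S i u (Function.update f u c) * G.stepProb u (f u) := by
    classical
    intro f c
    unfold walkMass stepProb
    simp only [occupied_update_iff]
    split_ifs
    · rw [← ENNReal.ofReal_mul (G.density_nonneg _), ← ENNReal.ofReal_mul (G.density_nonneg _),
        mul_div_assoc', mul_div_assoc', density_mul_pointerWeight]
    · simp
  simp only [Finset.mul_sum, ← mul_assoc]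
  rw [sum_sum_swap_update u]
  refine Finset.sum_congr rfl fun f _ => ?_
  simp only [← detailed_balance, Function.update_idem, Function.update_eq_self]
  rw [← Finset.sum_mul, ← Finset.mul_sum, sum_stepProb, mul_one]

theorem sum_walkMass_step (S : Set (Fin n)) (i u : Fin n)
    (h : PointerMap (Fin n) → Fin n → ℝ≥0∞) :
    ∑ f, G.walkMass S i u f *
      ∑ v, G.stepProb u (some v) * h (Function.update f u (some v)) v =
      ∑ f, G.walkMass S i u f * (f u).elim 0 (h f) := by
  rw [← G.sum_walkMass_resample S i u fun f => (f u).elim 0 (h f)]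
  simp [Fintype.sum_option]

theorem sum_walkMass_absorb (S : Set (Fin n)) (i u : Fin n) (h : PointerMap (Fin n) → ℝ≥0∞) :
    ∑ f, G.walkMass S i u f * (G.stepProb u none * h (Function.update f u none)) =
      ∑ f, G.walkMass S i u f * if f u = none then h f else 0 := by
  rw [← G.sum_walkMass_resample S i u fun f => if f u = none then h f else 0]
  simp

theorem mapProb_mul_add_sum_walkMass_elim_le (S : Set (Fin n)) (i : Fin n)
    (f : PointerMap (Fin n)) (h : Fin n → ℝ≥0∞) :
    G.mapProb f * h i + ∑ u, G.walkMass S i u f * (f u).elim 0 h ≤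
      ∑ u, (G.walkMass S i u f * h u + G.hitMass S i u f * h u) := by
  classical
  have key := mul_le_mul_right (sum_next_le_sum_occupied S i f h) (ENNReal.ofReal (G.density f))
  rw [mul_add, Finset.mul_sum, Finset.mul_sum, Finset.sum_filter, Finset.sum_filter] at key
  convert key using 2 with u
  · rw [mapProb_eq]
    split_ifs <;> simp
  · refine Finset.sum_congr rfl fun u _ => ?_
    unfold walkMass
    split_ifs <;> simp
  · unfold walkMass hitMass
    by_cases hu : u ∈ Reached f S <;> by_cases ho : Occupied S i u f <;> simp [ho, hu]

/-- Flow balance: all arrivals of the walk, at its start or by a step, are occupations. -/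
theorem sum_mapProb_add_sum_walkMass_le (S : Set (Fin n)) (i : Fin n)
    (h : PointerMap (Fin n) → Fin n → ℝ≥0∞) :
    ∑ f, G.mapProb f * h f i + ∑ u, ∑ f, G.walkMass S i u f *
        ∑ v, G.stepProb u (some v) * h (Function.update f u (some v)) v ≤
      ∑ u, ∑ f, G.walkMass S i u f * h f u + ∑ u, ∑ f, G.hitMass S i u f * h f u := by
  simp only [sum_walkMass_step]
  rw [Finset.sum_comm, Finset.sum_comm (γ := Fin n), Finset.sum_comm (γ := Fin n),
    ← Finset.sum_add_distrib, ← Finset.sum_add_distrib]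
  simp only [← Finset.sum_add_distrib]
  exact Finset.sum_le_sum fun f _ => G.mapProb_mul_add_sum_walkMass_elim_le S i f (h f)

theorem sum_walkMass_absorb_add_sum_hitMass (S : Set (Fin n)) (i : Fin n)
    (h : PointerMap (Fin n) → ℝ≥0∞) :
    ∑ u, ∑ f, G.walkMass S i u f * (G.stepProb u none * h (Function.update f u none)) +
      ∑ u, ∑ f, G.hitMass S i u f * h f = ∑ f, G.mapProb f * h f := by
  classical
  simp only [sum_walkMass_absorb]
  rw [Finset.sum_comm, Finset.sum_comm (γ := Fin n), ← Finset.sum_add_distrib]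
  refine Finset.sum_congr rfl fun f _ => ?_
  rw [← Finset.sum_add_distrib, mapProb_eq, ite_mul, zero_mul, ← sum_occupied_end S i f]
  refine Finset.sum_congr rfl fun u _ => ?_
  unfold walkMass hitMass
  by_cases h1 : Occupied S i u f <;> by_cases h2 : u ∈ Reached f S <;>
    by_cases h3 : f u = none <;> simp [h1, h2, h3]

/-- In applications `V` and `V'` are values of the walk cut off after `k` and `k + 1` tests. -/
theorem sum_mapProb_mul_le (S : Set (Fin n)) (i : Fin n) {V V' : Fin n × SampleState n → ℝ≥0∞}
    (hVV' : ∀ p, V p ≤ V' p) (hV : ∀ p, V p ≠ ∞) {a b : Fin n → PointerMap (Fin n) → ℝ≥0∞}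
    (ha : ∀ u f, u ∉ Reached f S → V' (u, forestState S f) ≤
      a u f + ∑ v, G.stepProb u (some v) * V (v, record u v (forestState S f)))
    (hb : ∀ u f, u ∈ Reached f S → V' (u, forestState S f) ≤ b u f) :
    ∑ f, G.mapProb f * V (i, forestState S f) ≤
      ∑ u, ∑ f, G.walkMass S i u f * a u f + ∑ u, ∑ f, G.hitMass S i u f * b u f := by
  set steps : ℝ≥0∞ := ∑ u, ∑ f, G.walkMass S i u f *
    ∑ v, G.stepProb u (some v) * V (v, forestState S (Function.update f u (some v))) with h_steps
  have steps_ne_top : steps ≠ ∞ :=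
    ENNReal.sum_ne_top.2 fun u _ => ENNReal.sum_ne_top.2 fun f _ =>
      ENNReal.mul_ne_top (G.walkMass_ne_top S i u f) (ENNReal.sum_ne_top.2 fun v _ =>
        ENNReal.mul_ne_top ENNReal.ofReal_ne_top (hV _))
  have walk_le : ∑ u, ∑ f, G.walkMass S i u f * V (u, forestState S f) ≤
      ∑ u, ∑ f, G.walkMass S i u f * a u f + steps := by
    simp only [h_steps, ← Finset.sum_add_distrib, ← mul_add]
    refine Finset.sum_le_sum fun u _ => Finset.sum_le_sum fun f _ => ?_
    by_cases hu : u ∈ Reached f S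
    · simp [walkMass, hu]
    · refine mul_le_mul_right ((hVV' _).trans ((ha u f hu).trans_eq ?_)) _
      simp only [record_forestState hu]
  have hit_le : ∑ u, ∑ f, G.hitMass S i u f * V (u, forestState S f) ≤
      ∑ u, ∑ f, G.hitMass S i u f * b u f := by
    refine Finset.sum_le_sum fun u _ => Finset.sum_le_sum fun f _ => ?_
    by_cases hu : u ∈ Reached f S
    · exact mul_le_mul_right ((hVV' _).trans (hb u f hu)) _
    · simp [hitMass, hu]
  refine (ENNReal.add_le_add_iff_right steps_ne_top).1 ?_
  calc ∑ f, G.mapProb f * V (i, forestState S f) + steps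
      ≤ _ := G.sum_mapProb_add_sum_walkMass_le S i fun f u => V (u, forestState S f)
    _ ≤ _ := add_le_add walk_le hit_le
    _ = _ := by ring

theorem sum_mapProb_mul_iSup_le {V : PointerMap (Fin n) → ℕ → ℝ≥0∞} (hV : ∀ f, Monotone (V f))
    {B : ℝ≥0∞} (h : ∀ k, ∑ f, G.mapProb f * V f k ≤ B) :
    ∑ f, G.mapProb f * ⨆ k, V f k ≤ B := by
  rw [← tsum_fintype (L := .unconditional _),
    tsum_mul_iSup_of_monotone (f := fun k f => V f k) G.mapProb hV]
  simpa only [tsum_fintype] using iSup_le h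

/-- The expectation of `g` at the end of the walk from `i` that is started from random records when
the nodes of `S` have been treated. -/
noncomputable def exitSum (S : Set (Fin n)) (i : Fin n) (g : Fin n × SampleState n → ℝ≥0∞) :
    ℝ≥0∞ :=
  ∑ u, ∑ f, G.walkMass S i u f * (G.stepProb u none * g (u, absorb u (forestState S f))) +
    ∑ u, ∑ f, G.hitMass S i u f * g (u, forestState S f)

theorem sum_expect_walk_le (S : Set (Fin n)) (i : Fin n) {g : Fin n × SampleState n → ℝ≥0∞}
    (hg : ∀ p, g p ≤ 1) :
    ∑ f, G.mapProb f * (whileLoop unvisited G.walkBody (i, forestState S f)).expect g ≤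
      G.exitSum S i g := by
  have mono : ∀ p, Monotone fun k => (whileFuel unvisited G.walkBody k p).expect g :=
    fun p => monotone_wp_whileFuel p _
  simp only [expect, wp_whileLoop]
  refine G.sum_mapProb_mul_iSup_le (fun f => mono _) fun k => ?_
  refine G.sum_mapProb_mul_le S i (V := fun p => (whileFuel unvisited G.walkBody k p).expect g)
    (V' := fun p => (whileFuel unvisited G.walkBody (k + 1) p).expect g)
    (fun p => mono p (Nat.le_succ k)) (fun p => ?_) (fun u f hu => ?_) fun u f hu => ?_
  · exact ne_top_of_le_ne_top ENNReal.one_ne_top (expect_le_of_le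
      (haltProb_whileFuel_le_one (fun p => (G.haltProb_walkBody p).le) k p) hg)
  · rw [expect_whileFuel_succ, if_pos (unvisited_forestState.2 hu), expect_walkBody]
    gcongr
    refine (mono _ (Nat.le_succ k)).trans ?_
    dsimp only
    rw [expect_whileFuel_succ, unvisited_absorb]
    simp
  · rw [expect_whileFuel_succ, if_neg fun h => unvisited_forestState.1 h hu]

theorem exitSum_add (S : Set (Fin n)) (i : Fin n) (g g' : Fin n × SampleState n → ℝ≥0∞) :
    G.exitSum S i (fun p => g p + g' p) = G.exitSum S i g + G.exitSum S i g' := by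
  simp only [exitSum, mul_add, Finset.sum_add_distrib]
  ring

theorem exitSum_one (S : Set (Fin n)) (i : Fin n) : G.exitSum S i (fun _ => 1) = 1 := by
  rw [exitSum, G.sum_walkMass_absorb_add_sum_hitMass S i fun _ => 1]
  simp [sum_mapProb]

theorem sum_expect_walk (S : Set (Fin n)) (i : Fin n) {g : Fin n × SampleState n → ℝ≥0∞}
    (hg : ∀ p, g p ≤ 1) :
    ∑ f, G.mapProb f * (whileLoop unvisited G.walkBody (i, forestState S f)).expect g =
      G.exitSum S i g := by
  -- Both sides are at most the right one, and for `g` and `1 - g` together they sum to `1`.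
  refine le_antisymm (G.sum_expect_walk_le S i hg) ?_
  have compl_le := G.sum_expect_walk_le S i (g := fun p => 1 - g p) fun p => tsub_le_self
  have add_compl : ∀ p, g p + (1 - g p) = 1 := fun p => add_tsub_cancel_of_le (hg p)
  have exitSum_add_compl := G.exitSum_add S i g fun p => 1 - g p
  simp only [add_compl, exitSum_one] at exitSum_add_compl
  have sum_add_compl :
      ∑ f, G.mapProb f * (whileLoop unvisited G.walkBody (i, forestState S f)).expect g +
        ∑ f, G.mapProb f *
          (whileLoop unvisited G.walkBody (i, forestState S f)).expect (fun p => 1 - g p) = 1 := by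
    rw [← Finset.sum_add_distrib]
    refine (Finset.sum_congr rfl fun f _ => ?_).trans G.sum_mapProb
    rw [← mul_add, ← expect_add]
    simp only [add_compl]
    exact (congrArg _ (G.haltProb_walk _)).trans (mul_one _)
  have compl_ne_top : G.exitSum S i (fun p => 1 - g p) ≠ ∞ :=
    ne_top_of_le_ne_top ENNReal.one_ne_top (le_add_self.trans_eq exitSum_add_compl.symm)
  refine (ENNReal.add_le_add_iff_right compl_ne_top).1 ?_
  exact exitSum_add_compl.symm.trans_le
    (sum_add_compl.symm.trans_le (add_le_add_right compl_le _))

theorem expect_visitNode (s : SampleState n) (i : Fin n) (g : SampleState n → ℝ≥0∞) :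
    (G.visitNode s i).expect g = (whileLoop unvisited G.walkBody (i, s)).expect fun p =>
      (whileLoop unvisited (retraceBody (p.2.root p.1)) (i, p.2)).expect fun q => g q.2 := by
  rw [visitNode_eq]
  simp only [expect_bind, expect_tick, expect_pure]

theorem sum_expect_visitNode (S : Set (Fin n)) (i : Fin n) (g : SampleState n → ℝ≥0∞) :
    ∑ f, G.mapProb f * (G.visitNode (forestState S f) i).expect g =
      ∑ f, G.mapProb f * g (forestState (insert i S) f) := by
  refine sum_mul_expect_eq_of_le_one _ _ _ (fun g hg => ?_) g
  simp only [expect_visitNode]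
  rw [G.sum_expect_walk S i fun p => expect_le_of_le
      (haltProb_whileLoop_le_one (fun q => (haltProb_retraceBody _ q).le) _) fun q => hg q.2,
    exitSum, ← G.sum_walkMass_absorb_add_sum_hitMass S i fun f => g (forestState (insert i S) f)]
  congr 1 <;> refine Finset.sum_congr rfl fun u _ => Finset.sum_congr rfl fun f _ => ?_
  · by_cases h : Occupied S i u f ∧ u ∉ Reached f S
    · have hp : PathAvoiding (Reached f S) (Function.update f u none) u i :=
        h.1.path.congr fun x hx _ => Function.update_of_ne hx _ _
      dsimp only
      rw [expect_retrace_absorb_forestState h.2 hp.leads]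
    · simp [walkMass, h]
  · by_cases h : Occupied S i u f ∧ u ∈ Reached f S
    · obtain ⟨r, hr⟩ := h.1.acyclic h.2 i
      dsimp only
      rw [expect_retrace_forestState hr h.2 h.1.path.leads]
    · simp [hitMass, h]

theorem sum_expect_foldlM_visitNode (l : List (Fin n)) (S : Set (Fin n))
    (g : SampleState n → ℝ≥0∞) :
    ∑ f, G.mapProb f * (List.foldlM G.visitNode (forestState S f) l).expect g =
      ∑ f, G.mapProb f * g (forestState (S ∪ {i | i ∈ l}) f) := by
  induction l generalizing S with
  | nil => simp [List.foldlM_nil, expect_pure]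
  | cons i l ih =>
    simp only [List.foldlM_cons, expect_bind]
    rw [G.sum_expect_visitNode S i fun s => (List.foldlM G.visitNode s l).expect g, ih]
    have hset : insert i S ∪ {j | j ∈ l} = S ∪ {j | j ∈ i :: l} := by
      ext x
      simp only [Set.mem_union, Set.mem_ofPred_eq, List.mem_cons, Set.mem_insert_iff]
      tauto
    rw [hset]

theorem wp_foldlM_init (g : SampleState n → ℕ → ℝ≥0∞) :
    wp (List.foldlM G.visitNode (SampleState.init n) (List.finRange n)) g =
      ∑ f, G.mapProb f * wp (List.foldlM G.visitNode (forestState ∅ f) (List.finRange n)) g := by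
  simp only [← G.wp_foldlM_visitNode_congr (sameForest_init _) g]
  rw [← Finset.sum_mul, sum_mapProb, one_mul]

theorem expect_sampleForest (g : SampleState n → ℝ≥0∞) :
    G.sampleForest.expect g = ∑ f, G.mapProb f * g (forestState Set.univ f) := by
  rw [sampleForest_eq, expect_bind, expect_tick, expect, wp_foldlM_init]
  refine (G.sum_expect_foldlM_visitNode (List.finRange n) ∅ g).trans ?_
  have huniv : (∅ : Set (Fin n)) ∪ {i | i ∈ List.finRange n} = Set.univ := by
    ext x
    simp
  rw [huniv]

end WeightedDigraph

namespace WeightedDigraph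

open PointerMap RandProg

variable {n : ℕ}

/-! ### The running time of a round -/

/-- The number of nodes outside the forest. It is the potential that pays for retracing. -/
def pending (s : SampleState n) : ℕ := (Finset.univ.filter fun a => s.inforest a = false).card

theorem pending_le (s : SampleState n) : pending s ≤ n :=
  (Finset.card_filter_le _ _).trans_eq (Finset.card_fin n)

theorem pending_absorb_le (u : Fin n) (s : SampleState n) : pending (absorb u s) ≤ pending s := by
  refine Finset.card_le_card fun a ha => ?_
  have ha' : Function.update s.inforest u true a = false := (Finset.mem_filter.1 ha).2
  refine Finset.mem_filter.2 ⟨Finset.mem_univ _, ?_⟩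
  by_cases hau : a = u
  · simp [hau] at ha'
  · rwa [Function.update_of_ne hau] at ha'

theorem pending_record (u v : Fin n) (s : SampleState n) : pending (record u v s) = pending s :=
  rfl

theorem pending_attach_add_one (r : Option (Fin n)) {u : Fin n} {s : SampleState n}
    (h : s.inforest u = false) : pending (attach r u s) + 1 = pending s := by
  have hu : u ∈ Finset.univ.filter fun a => s.inforest a = false := by simpa using h
  rw [pending, pending, ← Finset.card_erase_add_one hu]
  congr 2
  ext a
  simp only [Finset.mem_filter, Finset.mem_erase]
  by_cases hau : a = u <;> simp [attach, hau]

theorem expectedCost_retrace_add_le (r : Option (Fin n)) (p : Fin n × SampleState n) :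
    (whileLoop unvisited (retraceBody r) p).expectedCost +
      (whileLoop unvisited (retraceBody r) p).expect (fun q => 4 * pending q.2) ≤
      1 + 4 * pending p.2 := by
  refine expectedCost_whileLoop_add_expect_le (V := fun p => 1 + 4 * (pending p.2 : ℝ≥0∞))
    (fun p => (haltProb_retraceBody r p).le) (fun ⟨u, s⟩ => ?_) p
  split_ifs with hu
  · rw [expectedCost_eq_wp, expect, wp_retraceBody, wp_retraceBody]
    dsimp only
    rw [← pending_attach_add_one r (unvisited_eq_true.1 hu)]
    refine le_of_eq ?_
    push_cast
    ring
  · exact le_rfl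

variable (G : WeightedDigraph n)

theorem expect_walk_pending_le (p : Fin n × SampleState n) :
    (whileLoop unvisited G.walkBody p).expect (fun q => 4 * pending q.2) ≤ 4 * pending p.2 := by
  have body_le : ∀ p : Fin n × SampleState n, unvisited p = true →
      (G.walkBody p).expect (fun q => 4 * (pending q.2 : ℝ≥0∞)) ≤ 4 * pending p.2 := by
    rintro ⟨u, s⟩ -
    rw [expect_walkBody]
    simp only [pending_record]
    calc _ ≤ G.stepProb u none * (4 * pending s) +
          ∑ v, G.stepProb u (some v) * (4 * pending s) := by
          gcongr
          exact pending_absorb_le u s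
      _ = _ := by rw [← Finset.sum_mul, ← add_mul, stepProb_none_add, one_mul]
  exact expect_whileLoop_le body_le (fun _ _ => le_rfl) p

theorem expectedCost_visitNode_le (s : SampleState n) (i : Fin n) :
    (G.visitNode s i).expectedCost ≤ 2 + ((whileLoop unvisited G.walkBody (i, s)).expectedCost +
      (whileLoop unvisited G.walkBody (i, s)).expect fun p => 2 +
        (whileLoop unvisited (retraceBody (p.2.root p.1)) (i, p.2)).expectedCost) := by
  have halt_retrace : ∀ p : Fin n × SampleState n,
      (whileLoop unvisited (retraceBody (p.2.root p.1)) (i, p.2)).haltProb ≤ 1 :=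
    fun p => haltProb_whileLoop_le_one (fun q => (haltProb_retraceBody _ q).le) _
  have halt_pure : ∀ q : Fin n × SampleState n, (pure q.2 : RandProg _).haltProb ≤ 1 :=
    fun q => (haltProb_pure q.2).le
  have halt_tail := fun p => haltProb_bind_le_one (halt_retrace p) halt_pure
  have halt_tail' := fun p => haltProb_bind_le_one (haltProb_tick 2).le fun _ => halt_tail p
  rw [visitNode_eq]
  refine (expectedCost_tick_bind_le 2 _
    (haltProb_bind_le_one (G.haltProb_walk _).le halt_tail')).trans (add_le_add_right ?_ _)
  refine (expectedCost_bind_le _ _ halt_tail').trans (add_le_add_right (expect_mono fun p => ?_) _)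
  refine (expectedCost_tick_bind_le 2 _ (halt_tail p)).trans (add_le_add_right ?_ _)
  refine (expectedCost_bind_le _ _ halt_pure).trans_eq ?_
  simp only [expectedCost_pure]
  rw [expect_const, zero_mul, add_zero]

theorem expectedCost_visitNode_add_le (s : SampleState n) (i : Fin n) :
    (G.visitNode s i).expectedCost + (G.visitNode s i).expect (fun t => 4 * pending t) ≤
      (whileLoop unvisited G.walkBody (i, s)).expectedCost + 5 + 4 * pending s := by
  set walk := whileLoop unvisited G.walkBody (i, s) with h_walk
  rw [expect_visitNode, ← h_walk]
  calc _ ≤ 2 + (walk.expectedCost + walk.expect fun p => 2 +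
          (whileLoop unvisited (retraceBody (p.2.root p.1)) (i, p.2)).expectedCost) +
        walk.expect fun p => (whileLoop unvisited (retraceBody (p.2.root p.1)) (i, p.2)).expect
          fun q => 4 * pending q.2 := by
        gcongr
        exact G.expectedCost_visitNode_le s i
    _ ≤ 2 + (walk.expectedCost + walk.expect fun p => 3 + 4 * pending p.2) := by
        rw [add_assoc, add_assoc, ← expect_add]
        gcongr
        refine expect_mono fun p => ?_
        rw [add_assoc]
        refine (add_le_add_right (expectedCost_retrace_add_le _ _) _).trans_eq ?_
        rw [← add_assoc]
        norm_num
    _ ≤ 2 + (walk.expectedCost + (3 + 4 * pending s)) := by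
        rw [expect_add, expect_const, G.haltProb_walk, mul_one]
        gcongr
        exact G.expect_walk_pending_le (i, s)
    _ = _ := by ring

theorem expectedCost_walkFuel_ne_top (k : ℕ) (p : Fin n × SampleState n) :
    (whileFuel unvisited G.walkBody k p).expectedCost ≠ ∞ := by
  induction k generalizing p with
  | zero =>
    rw [expectedCost_eq_wp, wp_whileFuel_zero]
    exact ENNReal.zero_ne_top
  | succ k ih =>
    refine ne_top_of_le_ne_top ?_
      (expectedCost_whileFuel_succ_le (fun p => (G.haltProb_walkBody p).le) k p)
    rw [expect_walkBody]
    have step_ne_top : ∀ c q, G.stepProb p.1 c * (whileFuel unvisited G.walkBody k q).expectedCost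
        ≠ ∞ := fun c q => ENNReal.mul_ne_top ENNReal.ofReal_ne_top (ih q)
    have body_ne_top := ne_top_of_le_ne_top (ENNReal.natCast_ne_top _)
      (G.expectedCost_walkBody_le p.1 p.2)
    split_ifs
    · exact ENNReal.add_ne_top.2 ⟨ENNReal.one_ne_top, ENNReal.add_ne_top.2 ⟨body_ne_top,
        ENNReal.add_ne_top.2 ⟨step_ne_top _ _, ENNReal.sum_ne_top.2 fun v _ => step_ne_top _ _⟩⟩⟩
    · simp

theorem expectedCost_walkFuel_absorb_le (k : ℕ) (u : Fin n) (s : SampleState n) :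
    (whileFuel unvisited G.walkBody k (u, absorb u s)).expectedCost ≤ 1 := by
  refine (monotone_wp_whileFuel _ (fun _ c => (c : ℝ≥0∞)) (Nat.le_succ k)).trans ?_
  refine (expectedCost_whileFuel_succ_le (fun p => (G.haltProb_walkBody p).le) k _).trans ?_
  simp [unvisited_absorb]

theorem sum_hitMass_le (S : Set (Fin n)) (i : Fin n) : ∑ u, ∑ f, G.hitMass S i u f ≤ 1 := by
  rw [← G.exitSum_one S i, exitSum]
  simp only [mul_one]
  exact le_add_self

theorem sum_expectedCost_walk_le (S : Set (Fin n)) (i : Fin n) :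
    ∑ f, G.mapProb f * (whileLoop unvisited G.walkBody (i, forestState S f)).expectedCost ≤
      1 + ∑ u, ((outCount G.arcs u + 7 : ℕ) : ℝ≥0∞) * ∑ f, G.walkMass S i u f := by
  have mono : ∀ p, Monotone fun k => (whileFuel unvisited G.walkBody k p).expectedCost :=
    fun p => monotone_wp_whileFuel p fun _ k => (k : ℝ≥0∞)
  have succ_le := expectedCost_whileFuel_succ_le (cond := unvisited)
    fun p => (G.haltProb_walkBody p).le
  simp only [expectedCost_whileLoop]
  refine G.sum_mapProb_mul_iSup_le (fun f => mono _) fun k => ?_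
  refine (G.sum_mapProb_mul_le S i (fun p => mono p (Nat.le_succ k))
    (G.expectedCost_walkFuel_ne_top k) (a := fun u _ => (outCount G.arcs u + 7 : ℕ))
    (b := fun _ _ => 1) (fun u f hu => ?_) fun u f hu => ?_).trans ?_
  · refine (succ_le k _).trans ?_
    rw [if_pos (unvisited_forestState.2 hu), expect_walkBody, ← add_assoc, ← add_assoc]
    gcongr
    have stepProb_le : G.stepProb u none ≤ 1 := le_self_add.trans_eq (G.stepProb_none_add u)
    calc _ ≤ 1 + ((outCount G.arcs u + 5 : ℕ) : ℝ≥0∞) + 1 * 1 := by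
          gcongr
          · exact G.expectedCost_walkBody_le u _
          · exact G.expectedCost_walkFuel_absorb_le k u _
      _ = _ := by
          push_cast
          ring
  · refine (succ_le k _).trans ?_
    rw [if_neg (fun h => unvisited_forestState.1 h hu), add_zero]
  · simp only [mul_one, ← Finset.sum_mul]
    simp only [mul_comm _ ((_ : ℕ) : ℝ≥0∞)]
    rw [add_comm]
    exact add_le_add_left (G.sum_hitMass_le S i) _

open scoped Classical in
/-- The expected number of visits to `u` in the rest of a round, when the nodes of `S` have been
treated. Each visit ends the walk with probability `1 / (1 + d_u)`, which makes `u` a root. -/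
noncomputable def remainingVisits (S : Set (Fin n)) (u : Fin n) : ℝ≥0∞ :=
  ENNReal.ofReal (1 + G.deg u) * ∑ f, if f u = none ∧ u ∉ Reached f S then G.mapProb f else 0

theorem sum_walkMass_eq (S : Set (Fin n)) (i u : Fin n) :
    ∑ f, G.walkMass S i u f =
      ENNReal.ofReal (1 + G.deg u) * ∑ f, G.walkMass S i u f * if f u = none then 1 else 0 := by
  have mul_stepProb : ENNReal.ofReal (1 + G.deg u) * G.stepProb u none = 1 := by
    change _ * ENNReal.ofReal (1 / (1 + G.deg u)) = 1
    rw [← ENNReal.ofReal_mul (G.one_add_deg_pos u).le,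
      mul_one_div_cancel (G.one_add_deg_pos u).ne', ENNReal.ofReal_one]
  rw [← G.sum_walkMass_absorb S i u fun _ => 1]
  simp only [mul_one]
  rw [← Finset.sum_mul, mul_left_comm, mul_stepProb, mul_one]

theorem sum_walkMass_add_remainingVisits_le (S : Set (Fin n)) (i u : Fin n) :
    ∑ f, G.walkMass S i u f + G.remainingVisits (insert i S) u ≤ G.remainingVisits S u := by
  classical
  rw [sum_walkMass_eq, remainingVisits, remainingVisits, ← mul_add, ← Finset.sum_add_distrib]
  refine mul_le_mul_right (Finset.sum_le_sum fun f _ => ?_) _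
  by_cases hf : f u = none
  · by_cases h : Occupied S i u f ∧ u ∉ Reached f S
    · have hu : u ∈ Reached f (insert i S) := mem_reached_insert.2 (.inr h.1.path.leads)
      simp [walkMass, h, hf, hu, mapProb_eq, h.1.acyclic_of_end (.inr hf)]
    · rw [walkMass, if_neg h, zero_mul, zero_add]
      split_ifs with h1 h2
      · exact le_rfl
      · exact absurd ⟨hf, fun h' => h1.2 (mem_reached_insert.2 (.inl h'))⟩ h2
      · exact zero_le
      · exact le_rfl
  · simp [hf]

theorem remainingVisits_empty_le {W : ℝ} (hW : ∀ i j, G.w i j ≤ W) (u : Fin n) :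
    G.remainingVisits ∅ u ≤ ENNReal.ofReal (1 + W) := by
  classical
  have sum_eq : ∑ f, (if f u = none ∧ u ∉ Reached f ∅ then G.mapProb f else 0) =
      ENNReal.ofReal (G.forestProb (G.inForestsRootedAt u u)) := by
    rw [forestProb_eq_sum, Finset.sum_filter, ENNReal.ofReal_sum_of_nonneg]
    · refine Finset.sum_congr rfl fun f _ => ?_
      have hr : RootOf f u u ↔ f u = none := ⟨fun h => h.eq_none, .root⟩
      rw [mapProb_eq]
      by_cases h1 : Acyclic f <;> by_cases h2 : f u = none <;> simp [h1, h2, hr, reached_empty]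
    · intro f _
      split_ifs <;> simp [density_nonneg]
  rw [remainingVisits, sum_eq, ← ENNReal.ofReal_mul (G.one_add_deg_pos u).le]
  exact ENNReal.ofReal_le_ofReal (G.one_add_deg_mul_forestProb_self_le hW u)

/-- A bound for the expected cost of the rest of a round, up to a constant per node, when the nodes
of `S` have been treated. -/
noncomputable def remainingCost (S : Set (Fin n)) : ℝ≥0∞ :=
  ∑ u, ((outCount G.arcs u + 7 : ℕ) : ℝ≥0∞) * G.remainingVisits S u +
    ∑ f, G.mapProb f * (4 * pending (forestState S f))

theorem sum_expectedCost_visitNode_add_le (S : Set (Fin n)) (i : Fin n) :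
    ∑ f, G.mapProb f * (G.visitNode (forestState S f) i).expectedCost +
      G.remainingCost (insert i S) ≤ 6 + G.remainingCost S := by
  have visit_le : ∑ f, G.mapProb f * (G.visitNode (forestState S f) i).expectedCost +
      ∑ f, G.mapProb f * (4 * pending (forestState (insert i S) f)) ≤
      6 + ∑ u, ((outCount G.arcs u + 7 : ℕ) : ℝ≥0∞) * ∑ f, G.walkMass S i u f +
        ∑ f, G.mapProb f * (4 * pending (forestState S f)) := by
    rw [← G.sum_expect_visitNode S i fun s => 4 * pending s]
    simp only [← Finset.sum_add_distrib, ← mul_add]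
    calc _ ≤ ∑ f, G.mapProb f *
          ((whileLoop unvisited G.walkBody (i, forestState S f)).expectedCost + 5 +
            4 * pending (forestState S f)) := by
          refine Finset.sum_le_sum fun f _ => mul_le_mul_right ?_ _
          exact G.expectedCost_visitNode_add_le _ i
      _ = ∑ f, G.mapProb f * (whileLoop unvisited G.walkBody (i, forestState S f)).expectedCost +
          5 + ∑ f, G.mapProb f * (4 * pending (forestState S f)) := by
          simp only [mul_add, Finset.sum_add_distrib]
          rw [← Finset.sum_mul, sum_mapProb, one_mul]
      _ ≤ _ := by
          refine add_le_add_left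
            ((add_le_add_left (G.sum_expectedCost_walk_le S i) _).trans_eq ?_) _
          ring
  have visits_le : ∑ u, ((outCount G.arcs u + 7 : ℕ) : ℝ≥0∞) * ∑ f, G.walkMass S i u f +
      ∑ u, ((outCount G.arcs u + 7 : ℕ) : ℝ≥0∞) * G.remainingVisits (insert i S) u ≤
      ∑ u, ((outCount G.arcs u + 7 : ℕ) : ℝ≥0∞) * G.remainingVisits S u := by
    rw [← Finset.sum_add_distrib]
    simp only [← mul_add]
    gcongr
    exact G.sum_walkMass_add_remainingVisits_le S i _
  rw [remainingCost, remainingCost, add_left_comm]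
  refine (add_le_add_right visit_le _).trans ?_
  rw [← add_assoc, ← add_assoc, add_comm _ 6, add_assoc 6, add_assoc 6]
  gcongr
  exact (add_comm _ _).trans_le visits_le

theorem sum_expectedCost_foldlM_visitNode_le (l : List (Fin n)) (S : Set (Fin n)) :
    ∑ f, G.mapProb f * (List.foldlM G.visitNode (forestState S f) l).expectedCost ≤
      6 * l.length + G.remainingCost S := by
  induction l generalizing S with
  | nil => simp [List.foldlM_nil, expectedCost_pure]
  | cons i l ih =>
    calc _ ≤ ∑ f, G.mapProb f * ((G.visitNode (forestState S f) i).expectedCost +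
          (G.visitNode (forestState S f) i).expect fun s =>
            (List.foldlM G.visitNode s l).expectedCost) := by
          gcongr
          rw [List.foldlM_cons]
          exact expectedCost_bind_le _ _ (haltProb_foldlM_le_one G.haltProb_visitNode_le_one l)
      _ = ∑ f, G.mapProb f * (G.visitNode (forestState S f) i).expectedCost +
          ∑ f, G.mapProb f *
            (List.foldlM G.visitNode (forestState (insert i S) f) l).expectedCost := by
          simp only [mul_add, Finset.sum_add_distrib]
          rw [G.sum_expect_visitNode S i fun s => (List.foldlM G.visitNode s l).expectedCost]
      _ ≤ _ := add_le_add_right (ih (insert i S)) _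
      _ ≤ 6 * l.length + (6 + G.remainingCost S) := by
          rw [add_left_comm]
          exact add_le_add_right (G.sum_expectedCost_visitNode_add_le S i) _
      _ = _ := by
          rw [List.length_cons]
          push_cast
          ring

theorem sum_outCount (F : Finset (Fin n × Fin n)) : ∑ u, outCount F u = F.card :=
  (Finset.card_eq_sum_card_fiberwise fun e _ => Finset.mem_coe.2 (Finset.mem_univ e.1)).symm

theorem remainingCost_empty_le {W : ℝ} (hW : ∀ i j, G.w i j ≤ W) :
    G.remainingCost ∅ ≤ (G.arcs.card + 7 * n) * ENNReal.ofReal (1 + W) + 4 * n := by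
  refine add_le_add ?_ ?_
  · calc _ ≤ ∑ u, ((outCount G.arcs u + 7 : ℕ) : ℝ≥0∞) * ENNReal.ofReal (1 + W) := by
          gcongr
          exact G.remainingVisits_empty_le hW _
      _ = _ := by
          rw [← Finset.sum_mul, ← Nat.cast_sum, Finset.sum_add_distrib, sum_outCount]
          simp [mul_comm]
  · calc _ ≤ ∑ f, G.mapProb f * (4 * n) := by
          gcongr
          exact pending_le _
      _ = _ := by rw [← Finset.sum_mul, sum_mapProb, one_mul]

theorem expectedCost_sampleForest_le {W : ℝ} (hW : ∀ i j, G.w i j ≤ W) :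
    G.sampleForest.expectedCost ≤ 13 * n + (G.arcs.card + 7 * n) * ENNReal.ofReal (1 + W) := by
  have fold_le := G.sum_expectedCost_foldlM_visitNode_le (List.finRange n) ∅
  rw [sampleForest_eq]
  refine (expectedCost_tick_bind_le _ _
    (haltProb_foldlM_le_one G.haltProb_visitNode_le_one _ _)).trans ?_
  rw [expectedCost_eq_wp, wp_foldlM_init]
  rw [List.length_finRange] at fold_le
  calc _ ≤ ((3 * n : ℕ) : ℝ≥0∞) +
        (6 * n + ((G.arcs.card + 7 * n) * ENNReal.ofReal (1 + W) + 4 * n)) := by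
        gcongr
        exact fold_le.trans (add_le_add_right (G.remainingCost_empty_le hW) _)
    _ = _ := by
        push_cast
        ring

end WeightedDigraph

namespace WeightedDigraph

open PointerMap RandProg

variable {n : ℕ} (G : WeightedDigraph n)

/-! ### The sampled in-forest -/

theorem root_forestState_univ (f : PointerMap (Fin n)) (i : Fin n) :
    (forestState Set.univ f).root i = rootOf f i :=
  if_pos (subset_reached f _ (Set.mem_univ i))

theorem prob_nextArcs (φ : Finset (Fin n × Fin n)) :
    G.sampleForest.prob (fun s => s.nextArcs = φ) = G.forestPMF φ := by
  classical
  rw [prob_eq_expect, expect_sampleForest]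
  change ∑ f, G.forestPMF (pointerArcs f) * (if pointerArcs f = φ then 1 else 0) = _
  rw [← sum_eq_sum_pointerArcs (fun F => G.forestPMF F * if F = φ then 1 else 0) fun F hF =>
    exists_pointerArcs_of_forestPMF_ne_zero (left_ne_zero_of_mul hF)]
  simp

theorem mem_inForests_of_mapProb_ne_zero {f : PointerMap (Fin n)} (h : G.mapProb f ≠ 0) :
    pointerArcs f ∈ G.inForests := by
  classical
  rw [mapProb, forestPMF_apply] at h
  by_contra hF
  exact left_ne_zero_of_mul h (if_neg hF)

theorem prob_root :
    G.sampleForest.prob (fun s => ∀ i, ∃ j, s.root i = some j ∧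
      s.nextArcs ∈ G.inForestsRootedAt i j) = 1 := by
  classical
  rw [prob_eq_expect, expect_sampleForest]
  refine (Finset.sum_congr rfl fun f _ => ?_).trans G.sum_mapProb
  by_cases h : G.mapProb f = 0
  · rw [h, zero_mul]
  · have hf := G.pointerArcs_mem_inForests.1 (G.mem_inForests_of_mapProb_ne_zero h)
    rw [if_pos, mul_one]
    intro i
    obtain ⟨j, hj⟩ := hf.2 i
    exact ⟨j, (root_forestState_univ f i).trans (rootOf_eq_some hj),
      G.pointerArcs_mem_inForestsRootedAt.2 ⟨hf, hj⟩⟩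

/-! ### The estimate -/

theorem haltProb_sampleForest : G.sampleForest.haltProb = 1 := by
  rw [haltProb, expect_sampleForest]
  simp only [mul_one, sum_mapProb]

/-- One round of the algorithm `Sample`, updating the estimate `zhat`. It ignores its last argument,
the number of the round. -/
noncomputable def sampleRound (x : Fin n → ℝ) (τ : ℕ) (zhat : Fin n → ℝ) (_ : ℕ) :
    RandProg (Fin n → ℝ) :=
  G.sampleForest >>= fun s => tick (3 * n + 1) >>= fun _ =>
    pure fun i => zhat i + (s.root i).elim 0 x / (τ : ℝ)

theorem sample_eq (x : Fin n → ℝ) (τ : ℕ) :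
    G.sample x τ = tick (2 * n + G.arcs.card) >>= fun _ =>
      List.foldlM (G.sampleRound x τ) (fun _ => 0) (List.range τ) >>= fun zhat =>
        tick (4 * n + 1) >>= fun _ =>
          pure (zhat, ∑ i, (zhat i - (∑ i, zhat i) / (n : ℝ)) ^ 2) := rfl

theorem expect_sampleRound (x : Fin n → ℝ) (τ : ℕ) (zhat : Fin n → ℝ) (k : ℕ)
    (g : (Fin n → ℝ) → ℝ≥0∞) : (G.sampleRound x τ zhat k).expect g =
      ∑ f, G.mapProb f * g fun i => zhat i + (rootOf f i).elim 0 x / (τ : ℝ) := by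
  simp only [sampleRound, expect_bind, expect_tick, expect_pure, expect_sampleForest,
    root_forestState_univ]

theorem expect_sample (x : Fin n → ℝ) (τ : ℕ) (g : (Fin n → ℝ) → ℝ≥0∞) :
    ((G.sample x τ).expect fun out => g out.1) =
      expect (List.foldlM (G.sampleRound x τ) (fun _ => 0) (List.range τ)) g := by
  simp only [sample_eq, expect_bind, expect_tick, expect_pure]

theorem haltProb_sampleRound (x : Fin n → ℝ) (τ : ℕ) (zhat : Fin n → ℝ) (k : ℕ) :
    (G.sampleRound x τ zhat k).haltProb = 1 :=
  haltProb_bind_eq_one G.haltProb_sampleForest fun _ =>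
    haltProb_bind_eq_one (haltProb_tick _) fun _ => haltProb_pure _

theorem haltProb_sample (x : Fin n → ℝ) (τ : ℕ) : (G.sample x τ).haltProb = 1 :=
  (G.expect_sample x τ fun _ => 1).trans
    (haltProb_foldlM_eq_one (G.haltProb_sampleRound x τ) _ _)

theorem sum_toReal_mapProb : ∑ f, (G.mapProb f).toReal = 1 := by
  rw [← ENNReal.toReal_sum fun f _ => G.mapProb_ne_top f, sum_mapProb, ENNReal.toReal_one]

theorem sum_mapProb_mul_elim_rootOf (x : Fin n → ℝ) (i : Fin n) :
    ∑ f, (G.mapProb f).toReal * (rootOf f i).elim 0 x = G.equilibrium x i := by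
  classical
  rw [equilibrium_eq]
  simp only [forestProb_eq_sum, Finset.sum_mul, Finset.sum_filter, ite_and]
  rw [Finset.sum_comm]
  refine Finset.sum_congr rfl fun f _ => ?_
  rw [mapProb_eq]
  split_ifs with hf
  · obtain ⟨r, hr⟩ := hf i
    rw [rootOf_eq_some hr, ENNReal.toReal_ofReal (G.density_nonneg f), Finset.sum_eq_single r]
    · simp [hr]
    · intro j _ hj
      rw [if_neg fun h => hj (h.unique hr), zero_mul]
    · simp
  · simp

theorem hasMean_rounds (x : Fin n → ℝ) (τ : ℕ) (i : Fin n) (l : List ℕ) (zhat : Fin n → ℝ) :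
    HasMean (List.foldlM (G.sampleRound x τ) zhat l) (fun z => z i)
      (zhat i + l.length * (G.equilibrium x i / τ)) := by
  induction l generalizing zhat with
  | nil => simpa using hasMean_pure zhat fun z => z i
  | cons k l ih =>
    have mean_eq : ∑ f, (G.mapProb f).toReal * (zhat i + (rootOf f i).elim 0 x / τ +
        l.length * (G.equilibrium x i / τ)) =
        zhat i + (k :: l).length * (G.equilibrium x i / τ) := by
      simp only [mul_add, Finset.sum_add_distrib, ← Finset.sum_mul, mul_div_assoc',
        ← Finset.sum_div, sum_toReal_mapProb, sum_mapProb_mul_elim_rootOf, one_mul]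
      push_cast [List.length_cons]
      ring
    rw [← mean_eq]
    exact HasMean.bind G.mapProb_ne_top (G.expect_sampleRound x τ zhat k) fun f => ih _

theorem hasExpectation_sample (x : Fin n → ℝ) {τ : ℕ} (hτ : 0 < τ) (i : Fin n) :
    (G.sample x τ).HasExpectation (fun out => out.1 i) (G.equilibrium x i) := by
  have hτ' : (τ : ℝ) ≠ 0 := Nat.cast_ne_zero.2 hτ.ne'
  have rounds := G.hasMean_rounds x τ i (List.range τ) fun _ => 0
  rw [List.length_range, mul_div_cancel₀ _ hτ', zero_add] at rounds
  refine HasMean.hasExpectation ?_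
  simpa only [HasMean, G.expect_sample x τ fun z => ENNReal.ofReal (z i),
    G.expect_sample x τ fun z => ENNReal.ofReal (-z i)] using rounds

/-! ### The running time of the algorithm -/

theorem expectedCost_sampleRound_le (x : Fin n → ℝ) (τ : ℕ) (zhat : Fin n → ℝ) (k : ℕ) :
    (G.sampleRound x τ zhat k).expectedCost ≤ G.sampleForest.expectedCost + (3 * n + 1 : ℕ) := by
  have halt_tail : ∀ z : Fin n → ℝ,
      (tick (3 * n + 1) >>= fun _ => (pure z : RandProg (Fin n → ℝ))).haltProb ≤ 1 := fun z =>
    haltProb_bind_le_one (haltProb_tick _).le fun _ => (haltProb_pure z).le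
  refine (expectedCost_bind_le _ _ fun s => halt_tail _).trans (add_le_add_right ?_ _)
  refine expect_le_of_le G.haltProb_sampleForest.le fun s => ?_
  refine (expectedCost_tick_bind_le _ (fun _ => pure _) (haltProb_pure _).le).trans_eq ?_
  rw [expectedCost_pure, add_zero]

theorem expectedCost_sample_le_sampleForest (x : Fin n → ℝ) (τ : ℕ) :
    (G.sample x τ).expectedCost ≤ (2 * n + G.arcs.card : ℕ) +
      (τ * (G.sampleForest.expectedCost + (3 * n + 1 : ℕ)) + (4 * n + 1 : ℕ)) := by
  have halt_rounds := haltProb_foldlM_le_one (fun z k => (G.haltProb_sampleRound x τ z k).le)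
    (List.range τ) fun _ => 0
  have halt_tail : ∀ z : (Fin n → ℝ) × ℝ,
      (tick (4 * n + 1) >>= fun _ => (pure z : RandProg _)).haltProb ≤ 1 := fun z =>
    haltProb_bind_le_one (haltProb_tick _).le fun _ => (haltProb_pure z).le
  rw [sample_eq]
  refine (expectedCost_tick_bind_le _ _ (haltProb_bind_le_one halt_rounds fun z =>
    halt_tail _)).trans (add_le_add_right ?_ _)
  refine (expectedCost_bind_le _ _ fun z => halt_tail _).trans (add_le_add ?_ ?_)
  · simpa only [List.length_range] using expectedCost_foldlM_le
      (fun z k => (G.haltProb_sampleRound x τ z k).le) (G.expectedCost_sampleRound_le x τ)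
      (List.range τ) fun _ => 0
  · refine expect_le_of_le halt_rounds fun z => ?_
    refine (expectedCost_tick_bind_le _ (fun _ => pure _) (haltProb_pure _).le).trans_eq ?_
    rw [expectedCost_pure, add_zero]

theorem costBound_le {N m t W : ℝ} (hN : 1 ≤ N) (hm : 0 ≤ m) (ht : 1 ≤ t) (hW : 0 ≤ W) :
    2 * N + m + (t * (13 * N + (m + 7 * N) * (1 + W) + (3 * N + 1)) + (4 * N + 1)) ≤
      31 * (1 + W) * (t * (N + m)) := by
  have setup_le : 2 * N + m + (4 * N + 1) ≤ 7 * (N + m) := by linarith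
  have round_le : 13 * N + (m + 7 * N) * (1 + W) + (3 * N + 1) ≤ 24 * ((1 + W) * (N + m)) := by
    nlinarith [mul_nonneg hW hm, mul_nonneg hW (zero_le_one.trans hN)]
  have one_le : 1 ≤ t * (1 + W) := one_le_mul_of_one_le_of_one_le ht (by linarith)
  calc _ = 2 * N + m + (4 * N + 1) +
        t * (13 * N + (m + 7 * N) * (1 + W) + (3 * N + 1)) := by ring
    _ ≤ 7 * (N + m) * (t * (1 + W)) + t * (24 * ((1 + W) * (N + m))) := by
        refine add_le_add (setup_le.trans (le_mul_of_one_le_right ?_ one_le)) ?_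
        · linarith
        · exact mul_le_mul_of_nonneg_left round_le (zero_le_one.trans ht)
    _ = _ := by ring

theorem expectedCost_sample_le (hn : 0 < n) (x : Fin n → ℝ) {τ : ℕ} (hτ : 0 < τ) {W : ℝ}
    (hW : ∀ i j, G.w i j ≤ W) :
    (G.sample x τ).expectedCost ≤ ENNReal.ofReal (31 * (1 + W) * (τ * (n + G.arcs.card))) := by
  have hW0 : 0 ≤ W := (G.w_nonneg ⟨0, hn⟩ ⟨0, hn⟩).trans (hW _ _)
  lift W to NNReal using hW0
  have hK : ENNReal.ofReal (1 + W) = ((1 + W : NNReal) : ℝ≥0∞) := by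
    rw [← ENNReal.ofReal_coe_nnreal, NNReal.coe_add, NNReal.coe_one]
  calc _ ≤ ((2 * n + G.arcs.card : ℕ) : ℝ≥0∞) + (τ * (13 * n + (G.arcs.card + 7 * n) *
          ENNReal.ofReal (1 + W) + (3 * n + 1 : ℕ)) + (4 * n + 1 : ℕ)) := by
        refine (G.expectedCost_sample_le_sampleForest x τ).trans ?_
        gcongr
        exact G.expectedCost_sampleForest_le hW
    _ = ENNReal.ofReal ((2 * n + G.arcs.card) + (τ * (13 * n + (G.arcs.card + 7 * n) * (1 + W) +
          (3 * n + 1)) + (4 * n + 1))) := by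
        rw [hK, ENNReal.ofReal]
        norm_cast
        rw [Real.toNNReal_coe]
    _ ≤ _ := ENNReal.ofReal_le_ofReal (costBound_le (Nat.one_le_cast.2 hn) (Nat.cast_nonneg _)
        (Nat.one_le_cast.2 hτ) W.coe_nonneg)

end WeightedDigraph

theorem mainTheorem1 :
    ∃ C : ℝ, 0 < C ∧ ∀ n : ℕ, 0 < n →
      letI Claim : WeightedDigraph n → Prop := fun G =>
        -- `I + L` is invertible, and the opinions converge to `z = (I + L)⁻¹ x`
        IsUnit (1 + G.laplacian) ∧
        (∀ x y : Fin n → ℝ,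
          Tendsto (fun k => (G.fjUpdate x)^[k] y) atTop (𝓝 (G.equilibrium x))) ∧
        -- `z_i = ∑ⱼ ℙ(φ ∈ Γ_ij) x_j`
        (∀ (x : Fin n → ℝ) (i : Fin n),
          G.equilibrium x i = ∑ j, G.forestProb (G.inForestsRootedAt i j) * x j) ∧
        -- a round of the algorithm samples an in-forest with probability proportional to its
        -- weight, and `Rootindex[i]` is then the root of `i` in it
        (∀ φ : Finset (Fin n × Fin n),
          G.sampleForest.prob (fun s => s.nextArcs = φ) = G.forestPMF φ) ∧
        (G.sampleForest.prob (fun s => ∀ i, ∃ j, s.root i = some j ∧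
          s.nextArcs ∈ G.inForestsRootedAt i j) = 1) ∧
        (∀ (x : Fin n → ℝ) (τ : ℕ), 0 < τ →
          -- the algorithm halts with probability one, and its estimate is unbiased
          (G.sample x τ).prob (fun _ => True) = 1 ∧
          (∀ i, (G.sample x τ).HasExpectation (fun out => out.1 i) (G.equilibrium x i)) ∧
          -- expected running time `O(τ (n + m))` for bounded weights
          (∀ W : ℝ, (∀ i j, G.w i j ≤ W) →
            (G.sample x τ).expectedCost ≤
              ENNReal.ofReal (C * (1 + W) * (τ * (n + G.arcs.card)))))
      (∀ G : WeightedDigraph n, Claim G) ∧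
      (∀ H : WeightedHypergraph n, Claim H.projectedDigraph) := by
  refine ⟨31, by norm_num, fun n hn => ?_⟩
  refine (fun h => ⟨h, fun H => h H.projectedDigraph⟩ : (∀ G : WeightedDigraph n, _) → _) ?_
  intro G
  refine ⟨G.isUnit_one_add_laplacian, G.tendsto_fjUpdate, G.equilibrium_eq, G.prob_nextArcs,
    G.prob_root, fun x τ hτ => ⟨(RandProg.prob_true _).trans (G.haltProb_sample x τ),
      G.hasExpectation_sample x hτ, fun W hW => G.expectedCost_sample_le hn x hτ hW⟩⟩
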